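/- **Setting.** Let $\Phi,\Psi$ be Hermitian $2\times 2$ matrices with $\det\Phi<0$. For a $2\times2$ matrix $\Theta$ write $q_\Theta(\mu,\nu)=\begin{bmatrix}\mu\\ \nu\end{bmatrix}^H\Theta\begin{bmatrix}\mu\\ \nu\end{bmatrix}$, and let $$\mathcal C=\{(\mu,\nu)\in\mathbf C^2 \mid (\mu,\nu)\ne 0,\ q_\Phi(\mu,\nu)=0,\ q_\Psi(\mu,\nu)\le 0\}.$$ Assume that the subset of the closed complex plane represented by $\mathcal C$ in homogeneous coordinates is neither empty nor a singleton, i.e. $\mathcal C$ contains two linearly independent vectors. For $F,G\in\mathbf C^{p\times n}$ let $$\mathcal A(F,G)=\{a\in\mathbf C^n\mid (\mu G-\nu F)a=0 \text{ for some } (\mu,\nu)\in\mathcal C\}.$$ Let $F_i,G_i\in\mathbf C^{p_i\times n_i}$ and $E_i\in\mathbf C^{m_i\times n_i}$ ($i=1,2$), $F=\mathrm{diag}(F_1,F_2)$, $G=\mathrm{diag}(G_1,G_2)$, $E=\mathrm{diag}(E_1,E_2)$ (block-diagonal), $p=p_1+p_2$ and $\mathcal A=\mathcal A(F,G)$. Define,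 with finite sums of arbitrary length and $\inf\emptyset=+\infty$, $$g(X)=\inf\Big\{\sum_k\|Ea_k\|^2 \;\Big|\; X=\sum_k a_ka_k^H,\ a_k\in\mathcal A\Big\},\qquad h(Y)=\frac12\inf_{V,W} g\Big(\begin{bmatrix}V&Y\\Y^H&W\end{bmatrix}\Big)\quad (Y\in\mathbf C^{n_1\times n_2}),$$ and $h^*(Z)=\sup_Y\big(\Re\operatorname{tr}(Z^HY)-h(Y)\big)$ for $Z\in\mathbf C^{n_1\times n_2}$. **(a)** Assume that $\operatorname{rank}(\mu G-\nu F)=p$ for all $(\mu,\nu)\neq 0$. Then for every $Z\in\mathbf C^{n_1\times n_2}$ the following are equivalent: 1. $h^*(Z)=0$; 2. there are Hermitian $P,Q\in\mathbf C^{p\times p}$ with $Q\succeq 0$ and $$\begin{bmatrix}0&Z\\Z^H&0\end{bmatrix}-\begin{bmatrix}F\\G\end{bmatrix}^H(\Phi\otimes P+\Psi\otimes Q)\begin{bmatrix}F\\G\end{bmatrix}\preceq\begin{bmatrix}E_1^HE_1&0\\0&E_2^HE_2\end{bmatrix};$$ 3. $\Re(v^HZw)\le(\|E_1v\|^2+\|E_2w\|^2)/2$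 for all $(v,w)\in\mathcal A$; 4. $\Re(v^HZw)\le\|E_1v\|\,\|E_2w\|$ for all $(v,w)\in\mathcal A$. If they fail, then $h^*(Z)=+\infty$. **(b)** Let $A\in\mathbf C^{n_s\times n_s}$, $B\in\mathbf C^{n_s\times m}$, $C\in\mathbf C^{l\times n_s}$, $D\in\mathbf C^{l\times m}$, where $A$ has no eigenvalue $\lambda$ with $(\lambda,1)\in\mathcal C$. Take $p_1=0$, $n_1=l$, $p_2=n_s$, $n_2=n_s+m$, $G_2=[\,I\ \ 0\,]$, $F_2=[\,A\ \ B\,]$, $E_1=I$, $E_2=[\,0\ \ I\,]$, $Z=[\,C\ \ D\,]$ (so that $\mathcal A=\mathbf C^l\times\mathcal A_2$ with $\mathcal A_2=\mathcal A(F_2,G_2)$). Then condition 4 is equivalent to $\|Zw\|\le\|E_2w\|$ for all $w\in\mathcal A_2$, and also to the transfer-function bound $$\|D+C(\lambda I-A)^{-1}B\|_2\le1\ \text{ for all }(\lambda,1)\in\mathcal C,\qquad \|D\|_2\le 1\ \text{ if }(1,0)\in\mathcal C,$$ where $\|\cdot\|_2$ is the spectral norm. Moreover $h^*(Z)=0$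 if this bound holds and $h^*(Z)=+\infty$ otherwise; and if in addition $\operatorname{rank}(\mu G_2-\nu F_2)=n_s$ for all $(\mu,\nu)\ne0$, then the linear matrix inequality in 2 is feasible if and only if this bound holds. -/

import Mathlib

open Matrix
open scoped Kronecker ComplexOrder

namespace PencilGauge

noncomputable section

/-- The Euclidean norm of a complex vector. -/
def euclNorm {ι : Type*} [Fintype ι] (x : ι → ℂ) : ℝ :=
  ‖(WithLp.toLp 2 x : EuclideanSpace ℂ ι)‖

section
open scoped Matrix.Norms.L2Operator

/-- The spectral norm (largest singular value) of a complex matrix, that is, its operator norm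
with respect to the Euclidean norms. -/
def specNorm {l m : Type*} [Fintype l] [Fintype m] [DecidableEq m] (M : Matrix l m ℂ) : ℝ :=
  ‖M‖

end

/-- The quadratic form `q_Θ(μ, ν) = (μ, ν)ᴴ Θ (μ, ν)`; its value is real if `Θ` is Hermitian. -/
def quadForm (Θ : Matrix (Fin 2) (Fin 2) ℂ) (μ ν : ℂ) : ℂ :=
  star ![μ, ν] ⬝ᵥ (Θ *ᵥ ![μ, ν])

/-- The segment of a line or circle determined by `Φ` and `Ψ`, in homogeneous coordinates:
the nonzero pairs `(μ, ν)` with `q_Φ(μ, ν) = 0` and `q_Ψ(μ, ν) ≤ 0`. -/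
def curve (Φ Ψ : Matrix (Fin 2) (Fin 2) ℂ) : Set (ℂ × ℂ) :=
  {c | c ≠ 0 ∧ quadForm Φ c.1 c.2 = 0 ∧ (quadForm Ψ c.1 c.2).re ≤ 0}

/-- The subset of the closed complex plane represented by `curve Φ Ψ` is neither empty nor a
singleton: it has two elements that represent different points. -/
def CurveNontrivial (Φ Ψ : Matrix (Fin 2) (Fin 2) ℂ) : Prop :=
  ∃ c ∈ curve Φ Ψ, ∃ d ∈ curve Φ Ψ, c.1 * d.2 ≠ d.1 * c.2

/-- The set `𝒜` of the vectors `a` with `(μ G - ν F) a = 0` for some `(μ, ν)` on the curve. -/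
def dict {p n : Type*} [Fintype n] (Φ Ψ : Matrix (Fin 2) (Fin 2) ℂ) (F G : Matrix p n ℂ) :
    Set (n → ℂ) :=
  {a | ∃ c ∈ curve Φ Ψ, (c.1 • G - c.2 • F) *ᵥ a = 0}

/-- `μ G - ν F` has full row rank for all `(μ, ν) ≠ 0`. -/
def FullRowRank {p n : Type*} [Fintype p] [Fintype n] (F G : Matrix p n ℂ) : Prop :=
  ∀ μ ν : ℂ, (μ, ν) ≠ 0 → (μ • G - ν • F).rank = Fintype.card p

/-- The gauge
`g(X) = inf {∑ₖ ‖E aₖ‖² | X = ∑ₖ aₖ aₖᴴ, aₖ ∈ 𝒜}`, with finite sums of any length;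
it is `+∞` if `X` has no such decomposition. -/
def symmGauge {p n m : Type*} [Fintype n] [Fintype m] (Φ Ψ : Matrix (Fin 2) (Fin 2) ℂ)
    (F G : Matrix p n ℂ) (E : Matrix m n ℂ) (X : Matrix n n ℂ) : EReal :=
  ⨅ (r : ℕ) (a : Fin r → n → ℂ)
    (_ : (∀ k, a k ∈ dict Φ Ψ F G) ∧ X = ∑ k, vecMulVec (a k) (star (a k))),
    ((∑ k, euclNorm (E *ᵥ a k) ^ 2 : ℝ) : EReal)

/-- The block-diagonal matrix with diagonal blocks `M₁` and `M₂`. -/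
abbrev diagBlocks {p₁ p₂ n₁ n₂ : Type*} (M₁ : Matrix p₁ n₁ ℂ) (M₂ : Matrix p₂ n₂ ℂ) :
    Matrix (p₁ ⊕ p₂) (n₁ ⊕ n₂) ℂ :=
  fromBlocks M₁ 0 0 M₂

section NonSymmetric

variable {p₁ p₂ n₁ n₂ m₁ m₂ : Type*} [Fintype p₁] [Fintype p₂] [Fintype n₁] [Fintype n₂]
  [Fintype m₁] [Fintype m₂]

/-- The non-symmetric gauge `h(Y) = (1/2) inf_{V,W} g([V, Y; Yᴴ, W])`, where `g` is the gauge for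
the block-diagonal matrices `F = diag(F₁, F₂)`, `G = diag(G₁, G₂)`, `E = diag(E₁, E₂)`.
(`g` is `+∞` at matrices that are not Hermitian, so `V` and `W` may range over all matrices.) -/
def nonsymmGauge (Φ Ψ : Matrix (Fin 2) (Fin 2) ℂ) (F₁ G₁ : Matrix p₁ n₁ ℂ)
    (F₂ G₂ : Matrix p₂ n₂ ℂ) (E₁ : Matrix m₁ n₁ ℂ) (E₂ : Matrix m₂ n₂ ℂ)
    (Y : Matrix n₁ n₂ ℂ) : EReal :=
  ((1 / 2 : ℝ) : EReal) * ⨅ (V : Matrix n₁ n₁ ℂ) (W : Matrix n₂ n₂ ℂ),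
    symmGauge Φ Ψ (diagBlocks F₁ F₂) (diagBlocks G₁ G₂) (diagBlocks E₁ E₂)
      (fromBlocks V Y Yᴴ W)

/-- The convex conjugate `f*(Z) = sup_Y (Re tr(Zᴴ Y) - f(Y))` of an extended-valued function on
complex matrices, for the real inner product `Re tr(Zᴴ Y)`. -/
def conjugate (f : Matrix n₁ n₂ ℂ → EReal) (Z : Matrix n₁ n₂ ℂ) : EReal :=
  ⨆ Y : Matrix n₁ n₂ ℂ, (((Zᴴ * Y).trace.re : ℝ) : EReal) - f Y

/-- The stacked matrix `[F; G]`. -/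
def stack {p n : Type*} (F G : Matrix p n ℂ) : Matrix (Fin 2 × p) n ℂ :=
  Matrix.of fun i j => ![F, G] i.1 i.2 j

/-- There are a Hermitian `P` and a Hermitian `Q ⪰ 0` such that
`[0, Z; Zᴴ, 0] - [F; G]ᴴ (Φ ⊗ P + Ψ ⊗ Q) [F; G] ⪯ diag(E₁ᴴ E₁, E₂ᴴ E₂)`. -/
def LMIFeasible (Φ Ψ : Matrix (Fin 2) (Fin 2) ℂ) (F₁ G₁ : Matrix p₁ n₁ ℂ)
    (F₂ G₂ : Matrix p₂ n₂ ℂ) (E₁ : Matrix m₁ n₁ ℂ) (E₂ : Matrix m₂ n₂ ℂ)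
    (Z : Matrix n₁ n₂ ℂ) : Prop :=
  ∃ P Q : Matrix (p₁ ⊕ p₂) (p₁ ⊕ p₂) ℂ, P.IsHermitian ∧ Q.PosSemidef ∧
    (diagBlocks (E₁ᴴ * E₁) (E₂ᴴ * E₂)
      - (fromBlocks 0 Z Zᴴ 0
        - (stack (diagBlocks F₁ F₂) (diagBlocks G₁ G₂))ᴴ * (Φ ⊗ₖ P + Ψ ⊗ₖ Q)
          * stack (diagBlocks F₁ F₂) (diagBlocks G₁ G₂))).PosSemidef

end NonSymmetric

/-- The bound `‖D + C (λ I - A)⁻¹ B‖₂ ≤ 1` for all `(λ, 1)` on the curve, together with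
`‖D‖₂ ≤ 1` if the point at infinity `(1, 0)` is on the curve. -/
def TransferBound {s m l : Type*} [Fintype s] [Fintype m] [Fintype l] [DecidableEq s]
    [DecidableEq m] (Φ Ψ : Matrix (Fin 2) (Fin 2) ℂ) (A : Matrix s s ℂ) (B : Matrix s m ℂ)
    (C : Matrix l s ℂ) (D : Matrix l m ℂ) : Prop :=
  (∀ z : ℂ, (z, (1 : ℂ)) ∈ curve Φ Ψ →
    specNorm (D + C * (z • (1 : Matrix s s ℂ) - A)⁻¹ * B) ≤ 1) ∧
  (((1 : ℂ), (0 : ℂ)) ∈ curve Φ Ψ → specNorm D ≤ 1)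

end

end PencilGauge

/-! Condition 3 says that the quadratic form of `diag(E₁ᴴE₁, E₂ᴴE₂) - [0, Z; Zᴴ, 0]` is
nonnegative on `𝒜`. Under this bound every decomposition `∑ aₖaₖᴴ` with off-diagonal block `Y`
costs at least `2 Re tr (Zᴴ Y)`, so `h*(Z) = 0`. A pair `(v, w)` violating it makes
`Re tr (Zᴴ Y) - h(Y)` positive at `Y = vwᴴ`, and scaling the pair drives `h*(Z)` to `+∞`. Since
`v` and `w` can be scaled independently, the sum in condition 3 may be replaced by the product in
condition 4.

The equivalence with the matrix inequality is the generalized Kalman-Yakubovich-Popov lemma. A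
congruence carries `Φ`, a multiple of `Φ` being added to `Ψ`, to the form of the real line, and
two points of the curve to `(1, 0)` and `(0, 1)`; then `Ψ` imposes either no condition or, after
one more congruence, that of the half-line `[0, ∞]`. In these two cases the matrices admitting
multipliers form a closed cone, because by full row rank the solutions of `F a = t G a`, `t > 0`,
span the whole space. A matrix without multipliers is therefore separated from it by some `X ⪰ 0`
for which `F X Gᴴ` is Hermitian, and positive semidefinite in the half-line case. If `F X Gᴴ` is
invertible, which a small perturbation achieves, then `X` is a sum of matrices `aaᴴ` with `a ∈ 𝒜`,
on which the given form is nonnegative: a contradiction. -/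

namespace PencilGauge

section Pencil

variable {K E E' : Type*} [Field K] [AddCommGroup E] [Module K E] [AddCommGroup E'] [Module K E']
  {F G H : E →ₗ[K] E'}

theorem map_sub_smul_eq_map_of_le_ker {t t₀ : K} (ht : t ≠ t₀) {W : Submodule K E}
    (hW : W ≤ LinearMap.ker (F - t • G)) : W.map (F - t₀ • G) = W.map G := by
  have h : (F - t₀ • G) ∘ₗ W.subtype = ((t - t₀) • G) ∘ₗ W.subtype := by
    ext x
    have hx : F x - t • G x = 0 := hW x.2
    change F x - t₀ • G x = (t - t₀) • G x
    rw [sub_eq_zero.1 hx, sub_smul]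
  rw [← W.range_subtype, ← LinearMap.range_comp, h, LinearMap.range_comp,
    Submodule.map_smul _ _ _ (sub_ne_zero.2 ht)]

variable [IsAlgClosed K] [FiniteDimensional K E]

theorem eq_top_of_map_eq_map_of_ker_le (hH : Function.Surjective H)
    (hG : ∀ κ : K, Function.Surjective (G - κ • H)) {W : Submodule K E}
    (hker : LinearMap.ker H ≤ W) (hmap : W.map G = W.map H) : W = ⊤ := by
  by_contra hW
  have : Nontrivial (E ⧸ W) := Submodule.Quotient.nontrivial_iff.2 hW
  have hsurj {L : E →ₗ[K] E'} (hL : Function.Surjective L) (h : W ≤ (W.map H).comap L) :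
      Function.Surjective (W.mapQ _ L h) := by
    rw [← LinearMap.range_eq_top, Submodule.range_mapQ, LinearMap.range_eq_top.2 hL,
      Submodule.map_top, Submodule.range_mkQ]
  have hcomap : (W.map H).comap H = W := by rwa [Submodule.comap_map_eq, sup_eq_left]
  have hinj : Function.Injective (W.mapQ _ H hcomap.ge) := by
    rw [← LinearMap.ker_eq_bot, Submodule.ker_mapQ, hcomap, Submodule.mkQ_map_self]
  let e : (E ⧸ W) ≃ₗ[K] E' ⧸ W.map H := .ofBijective _ ⟨hinj, hsurj hH hcomap.ge⟩
  have hWG : W ≤ (W.map H).comap G := Submodule.map_le_iff_le_comap.1 hmap.le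
  -- An eigenvalue `κ` of `H⁻¹ G` on `E ⧸ W` makes `G - κ H` singular there.
  obtain ⟨κ, hκ⟩ := Module.End.exists_eigenvalue (e.symm.toLinearMap ∘ₗ W.mapQ _ G hWG)
  obtain ⟨v, hv⟩ := hκ.exists_hasEigenvector
  have hWκ : W ≤ (W.map H).comap (G - κ • H) := fun x hx =>
    (W.map H).sub_mem (hWG hx) ((W.map H).smul_mem κ (hcomap.ge hx))
  have hvker : W.mapQ _ (G - κ • H) hWκ v = 0 := by
    have hGv : W.mapQ _ G hWG v = κ • e v := by
      rw [← map_smul, ← hv.apply_eq_smul, LinearMap.comp_apply, LinearEquiv.coe_coe,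
        e.apply_symm_apply]
    obtain ⟨x, rfl⟩ := W.mkQ_surjective v
    exact sub_eq_zero.2 hGv
  have : FiniteDimensional K (E' ⧸ W.map H) := e.finiteDimensional
  have hκinj : Function.Injective (W.mapQ _ (G - κ • H) hWκ) :=
    (LinearMap.injective_iff_surjective_of_finrank_eq_finrank e.finrank_eq).2 (hsurj (hG κ) hWκ)
  exact hv.2 (hκinj (hvker.trans (map_zero _).symm))

theorem iSup_ker_sub_smul_eq_top
    (hsurj : ∀ μ ν : K, (μ, ν) ≠ 0 → Function.Surjective (μ • G - ν • F)) {S : Set K}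
    (hS : S.Infinite) : ⨆ t ∈ S, LinearMap.ker (F - t • G) = ⊤ := by
  classical
  let W (T : Finset K) : Submodule K E := ⨆ t ∈ S \ T, LinearMap.ker (F - t • G)
  have hWanti {T T' : Finset K} (h : T ⊆ T') : W T' ≤ W T :=
    biSup_mono fun t ht => ⟨ht.1, fun htT => ht.2 (h htT)⟩
  -- Once `W T` is minimal, omitting one more point `t₀` does not change it.
  obtain ⟨_, ⟨T, rfl⟩, hmin⟩ := exists_minimal_of_wellFoundedLT (· ∈ Set.range W) ⟨W ∅, ∅, rfl⟩
  obtain ⟨t₀, ht₀⟩ := (hS.sdiff T.finite_toSet).nonempty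
  have hinsert : W T = W (insert t₀ T) :=
    le_antisymm (hmin ⟨_, rfl⟩ (hWanti (T.subset_insert t₀))) (hWanti (T.subset_insert t₀))
  have hmap : (W T).map G = (W T).map (F - t₀ • G) := by
    simp only [hinsert, W, Submodule.map_iSup]
    refine iSup_congr fun t => iSup_congr fun ht => ?_
    refine (map_sub_smul_eq_map_of_le_ker ?_ le_rfl).symm
    rintro rfl
    exact ht.2 (T.mem_insert_self t)
  have htop : W T = ⊤ := by
    refine eq_top_of_map_eq_map_of_ker_le ?_ (fun κ => ?_)
      (le_biSup (fun t => LinearMap.ker (F - t • G)) ht₀) hmap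
    · convert hsurj (-t₀) (-1) (by simp) using 2
      module
    · convert hsurj (1 + κ * t₀) κ ?_ using 2
      · module
      · intro h
        obtain ⟨h1, rfl⟩ := Prod.mk_eq_zero.1 h
        simp at h1
  exact eq_top_iff.2 (htop.ge.trans (hWanti T.empty_subset |>.trans (by simp [W])))

end Pencil

section FullRowRank

variable {p n : Type*} [Fintype p] [Fintype n] {F G : Matrix p n ℂ}

theorem rank_eq_card_iff_surjective_mulVec {K : Type*} [Field K] {M : Matrix p n K} :
    M.rank = Fintype.card p ↔ Function.Surjective M.mulVec := by
  rw [rank, ← Module.finrank_fintype_fun_eq_card K, ← coe_mulVecLin, ← LinearMap.range_eq_top]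
  exact ⟨Submodule.eq_top_of_finrank_eq, fun h => by rw [h, finrank_top]⟩

theorem fullRowRank_iff_surjective_mulVec : FullRowRank F G ↔
    ∀ μ ν : ℂ, (μ, ν) ≠ 0 → Function.Surjective (μ • G - ν • F).mulVec := by
  simp only [FullRowRank, rank_eq_card_iff_surjective_mulVec]

theorem FullRowRank.eq_zero_of_vecMul_eq_zero (h : FullRowRank F G) {μ ν : ℂ}
    (hμν : (μ, ν) ≠ 0) {z : p → ℂ} (hz : z ᵥ* (μ • G - ν • F) = 0) : z = 0 := by
  obtain ⟨a, ha⟩ := fullRowRank_iff_surjective_mulVec.1 h μ ν hμν (star z)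
  rw [← dotProduct_self_star_eq_zero, ← ha, dotProduct_mulVec, hz, zero_dotProduct]

theorem FullRowRank.eq_zero_of_mul_eq_zero {k : Type*} (h : FullRowRank F G)
    {N : Matrix k p ℂ} (hN : N * G = 0) : N = 0 := by
  refine funext fun i => h.eq_zero_of_vecMul_eq_zero (μ := 1) (ν := 0) (by simp) ?_
  rw [one_smul, zero_smul, sub_zero]
  exact congrFun hN i

theorem FullRowRank.span_eq_top (h : FullRowRank F G) :
    Submodule.span ℂ {a | ∃ t : ℝ, 0 < t ∧ F *ᵥ a = (t : ℂ) • G *ᵥ a} = ⊤ := by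
  have hsurj : ∀ μ ν : ℂ, (μ, ν) ≠ 0 →
      Function.Surjective (μ • G.mulVecLin - ν • F.mulVecLin) := by
    intro μ ν hμν
    have hmulVec : ⇑(μ • G.mulVecLin - ν • F.mulVecLin) = (μ • G - ν • F).mulVec := by
      ext1 a
      simp [sub_mulVec, smul_mulVec]
    rw [hmulVec]
    exact fullRowRank_iff_surjective_mulVec.1 h μ ν hμν
  rw [← top_le_iff, ← iSup_ker_sub_smul_eq_top hsurj
    ((Set.Ioi_infinite (0 : ℝ)).image Complex.ofReal_injective.injOn), iSup₂_le_iff]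
  rintro _ ⟨t, ht, rfl⟩ a ha
  exact Submodule.subset_span ⟨t, ht, sub_eq_zero.1 ha⟩

theorem FullRowRank.eq_zero_of_forall_mulVec_eq_zero {k : Type*} (h : FullRowRank F G)
    {N : Matrix k n ℂ}
    (hN : ∀ t : ℝ, 0 < t → ∀ a, F *ᵥ a = (t : ℂ) • G *ᵥ a → N *ᵥ a = 0) : N = 0 := by
  have hker : LinearMap.ker N.mulVecLin = ⊤ := by
    rw [← top_le_iff, ← h.span_eq_top, Submodule.span_le]
    rintro a ⟨t, ht, ha⟩
    exact hN t ht a ha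
  exact mulVec_injective (funext fun a => by
    rw [zero_mulVec]
    exact LinearMap.congr_fun (LinearMap.ker_eq_top.1 hker) a)

end FullRowRank

section ConeImage

variable {V W : Type*} [NormedAddCommGroup V] [NormedSpace ℝ V] [FiniteDimensional ℝ V]
  [NormedAddCommGroup W] [NormedSpace ℝ W] {C : ProperCone ℝ V} {L : V →L[ℝ] W}

theorem exists_pos_forall_mul_norm_le (hker : ∀ x ∈ C, L x = 0 → x = 0) :
    ∃ δ > 0, ∀ x ∈ C, δ * ‖x‖ ≤ ‖L x‖ := by
  have := FiniteDimensional.proper_real V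
  have hK : IsCompact (Metric.sphere (0 : V) 1 ∩ C) :=
    (isCompact_sphere 0 1).inter_right C.isClosed
  obtain ⟨δ, hδ, hmin⟩ : ∃ δ > 0, ∀ x ∈ Metric.sphere (0 : V) 1 ∩ C, δ ≤ ‖L x‖ := by
    refine hK.exists_forall_le' L.continuous.norm.continuousOn fun x hx =>
      norm_pos_iff.2 fun h => ?_
    simpa [hker x hx.2 h] using hx.1
  refine ⟨δ, hδ, fun x hx => ?_⟩
  rcases eq_or_ne x 0 with rfl | hx0
  · simp
  have hn : 0 < ‖x‖ := norm_pos_iff.2 hx0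
  have hle := hmin (‖x‖⁻¹ • x)
    ⟨by simp [norm_smul, hn.ne'], C.smul_mem hx (inv_nonneg.2 hn.le)⟩
  rwa [map_smul, norm_smul, norm_inv, norm_norm, ← div_eq_inv_mul, le_div_iff₀ hn] at hle

theorem isClosed_image_of_forall_eq_zero (hker : ∀ x ∈ C, L x = 0 → x = 0) :
    IsClosed (L '' C) := by
  have := FiniteDimensional.proper_real V
  obtain ⟨δ, hδ, hbound⟩ := exists_pos_forall_mul_norm_le hker
  have hproper : IsProperMap ((C : Set V).domRestrict L) := by
    refine isProperMap_iff_isCompact_preimage.2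
      ⟨L.continuous.comp continuous_subtype_val, fun K hK => ?_⟩
    obtain ⟨R, hR⟩ := hK.isBounded.exists_norm_le
    have hKC : IsCompact (Metric.closedBall 0 (R / δ) ∩ (C ∩ L ⁻¹' K)) :=
      (isCompact_closedBall 0 _).inter_right (C.isClosed.inter (hK.isClosed.preimage L.continuous))
    rw [Topology.IsInducing.subtypeVal.isCompact_iff]
    convert hKC
    ext x
    constructor
    · rintro ⟨x, hx, rfl⟩
      refine ⟨?_, x.2, hx⟩
      rw [mem_closedBall_zero_iff, le_div_iff₀' hδ]
      exact (hbound x x.2).trans (hR _ hx)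
    · exact fun hx => ⟨⟨x, hx.2.1⟩, hx.2.2, rfl⟩
  rw [← Set.range_domRestrict]
  exact hproper.isClosedMap.isClosed_range

end ConeImage

section PosSemidefCone

variable {n : Type*} [Fintype n]

theorem posSemidef_iff_re_nonneg {M : Matrix n n ℂ} :
    M.PosSemidef ↔ M.IsHermitian ∧ ∀ x, 0 ≤ (star x ⬝ᵥ M *ᵥ x).re := by
  refine ⟨fun h => ⟨h.isHermitian, fun x => h.re_dotProduct_nonneg x⟩, fun ⟨hM, hre⟩ => ?_⟩
  exact .of_dotProduct_mulVec_nonneg hM fun x =>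
    Complex.nonneg_iff.2 ⟨hre x, (hM.im_star_dotProduct_mulVec_self x).symm⟩

theorem trace_mul_vecMulVec {R m : Type*} [CommSemiring R] [Fintype m] (X : Matrix m n R)
    (v : n → R) (w : m → R) : (X * vecMulVec v w).trace = w ⬝ᵥ X *ᵥ v := by
  rw [mul_vecMulVec, trace_vecMulVec, dotProduct_comm]

open scoped MatrixOrder Matrix.Norms.L2Operator in
theorem isClosed_setOf_posSemidef (n : Type*) [Finite n] :
    IsClosed {M : Matrix n n ℂ | M.PosSemidef} := by
  classical
  have := Fintype.ofFinite n
  simpa only [nonneg_iff_posSemidef] using CStarAlgebra.isClosed_nonneg (A := Matrix n n ℂ)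

/-- The closed convex cone of the positive semidefinite matrices. -/
def posSemidefCone (n : Type*) [Finite n] : ProperCone ℝ (Matrix n n ℂ) where
  carrier := {M | M.PosSemidef}
  zero_mem' := .zero
  add_mem' := .add
  smul_mem' r _ hM := hM.smul r.2
  isClosed' := isClosed_setOf_posSemidef n

/-- The real subspace of the Hermitian matrices, as a closed convex cone. -/
noncomputable def hermitianCone (n : Type*) : ProperCone ℝ (Matrix n n ℂ) where
  toSubmodule := (selfAdjoint.submodule ℝ (Matrix n n ℂ)).restrictScalars _
  isClosed' := isClosed_eq (by fun_prop) continuous_id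

theorem exists_forall_eq_re_trace_mul (f : Matrix n n ℂ →ₗ[ℝ] ℝ) :
    ∃ Y : Matrix n n ℂ, ∀ H, f H = (Y * H).trace.re := by
  let B : Matrix n n ℂ →ₗ[ℝ] Module.Dual ℝ (Matrix n n ℂ) :=
    (LinearMap.mul ℝ (Matrix n n ℂ)).compr₂ (Complex.reLm ∘ₗ traceLinearMap n ℝ ℂ)
  have hB : Function.Injective B := by
    rw [← LinearMap.ker_eq_bot, LinearMap.ker_eq_bot']
    intro Y hY
    have h : (Y * Yᴴ).trace.re = 0 := LinearMap.congr_fun hY Yᴴ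
    have him := (Complex.nonneg_iff.1 (posSemidef_self_mul_conjTranspose Y).trace_nonneg).2
    exact trace_mul_conjTranspose_self_eq_zero_iff.1 (Complex.ext h him.symm)
  obtain ⟨Y, hY⟩ := (LinearMap.injective_iff_surjective_of_finrank_eq_finrank
    Subspace.dual_finrank_eq.symm).1 hB f
  exact ⟨Y, fun H => (LinearMap.congr_fun hY H).symm⟩

theorem exists_isHermitian_forall_eq_re_trace_mul (f : Matrix n n ℂ →ₗ[ℝ] ℝ) :
    ∃ X : Matrix n n ℂ, X.IsHermitian ∧ ∀ H, H.IsHermitian → f H = (X * H).trace.re := by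
  obtain ⟨Y, hY⟩ := exists_forall_eq_re_trace_mul f
  refine ⟨(1 / 2 : ℝ) • (Y + Yᴴ), ?_, fun H hH => ?_⟩
  · exact (isHermitian_add_transpose_self Y).smul (IsSelfAdjoint.all _)
  · have hconj : (Yᴴ * H).trace.re = (Y * H).trace.re := by
      rw [← hH.eq, ← conjTranspose_mul, trace_conjTranspose, trace_mul_comm, hH.eq]
      rfl
    rw [hY, smul_mul, trace_smul, Complex.smul_re, add_mul, trace_add, Complex.add_re, hconj,
      smul_eq_mul]
    ring

theorem exists_isHermitian_re_trace_mul_neg {K : ProperCone ℝ (Matrix n n ℂ)}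
    (hK : ∀ H ∈ K, H.IsHermitian) {M : Matrix n n ℂ} (hM : M.IsHermitian) (hMK : M ∉ K) :
    ∃ X : Matrix n n ℂ, X.IsHermitian ∧ (∀ H ∈ K, 0 ≤ (X * H).trace.re) ∧
      (X * M).trace.re < 0 := by
  have : LocallyConvexSpace ℝ (Matrix n n ℂ) :=
    inferInstanceAs (LocallyConvexSpace ℝ (n → n → ℂ))
  obtain ⟨f, hf, hfM⟩ := K.hyperplane_separation_point hMK
  obtain ⟨X, hX, hfX⟩ := exists_isHermitian_forall_eq_re_trace_mul f.toLinearMap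
  exact ⟨X, hX, fun H hH => hfX H (hK H hH) ▸ hf H hH, hfX M hM ▸ hfM⟩

end PosSemidefCone

section Multipliers

variable {p n : Type*} [Fintype p]

/-- The matrix `[F; G]ᴴ (Θ ⊗ P) [F; G]`, as a linear function of the multiplier `P`. -/
def pencilForm (Θ : Matrix (Fin 2) (Fin 2) ℂ) (F G : Matrix p n ℂ) :
    Matrix p p ℂ →ₗ[ℂ] Matrix n n ℂ where
  toFun P := (stack F G)ᴴ * (Θ ⊗ₖ P) * stack F G
  map_add' P Q := by rw [kronecker_add, Matrix.mul_add, Matrix.add_mul]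
  map_smul' c P := by rw [kronecker_smul, Matrix.mul_smul, Matrix.smul_mul, RingHom.id_apply]

theorem pencilForm_apply (Θ : Matrix (Fin 2) (Fin 2) ℂ) (F G : Matrix p n ℂ) (P : Matrix p p ℂ) :
    pencilForm Θ F G P = Θ 0 0 • (Fᴴ * P * F) + Θ 0 1 • (Fᴴ * P * G) + Θ 1 0 • (Gᴴ * P * F)
      + Θ 1 1 • (Gᴴ * P * G) := by
  have hentry (θ : ℂ) (A B : Matrix p n ℂ) (i j : n) :
      ∑ x, ∑ y, star (A y i) * (θ * P y x) * B x j
        = ∑ x, ∑ y, θ * (star (A y i) * P y x * B x j) :=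
    Finset.sum_congr rfl fun x _ => Finset.sum_congr rfl fun y _ => by ring
  ext i j
  simp only [pencilForm, LinearMap.coe_mk, AddHom.coe_mk, mul_apply, stack,
    Fintype.sum_prod_type, Fin.sum_univ_two, conjTranspose_apply, of_apply, kroneckerMap_apply,
    Matrix.add_apply, Matrix.smul_apply, smul_eq_mul, Finset.mul_sum, Finset.sum_mul, add_mul,
    Finset.sum_add_distrib, cons_val_zero, cons_val_one, hentry]
  ring

theorem isHermitian_pencilForm {Θ : Matrix (Fin 2) (Fin 2) ℂ} (hΘ : Θ.IsHermitian)
    (F G : Matrix p n ℂ) {P : Matrix p p ℂ} (hP : P.IsHermitian) :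
    (pencilForm Θ F G P).IsHermitian :=
  isHermitian_conjTranspose_mul_mul _ (by
    rw [IsHermitian, conjTranspose_kronecker, hΘ.eq, hP.eq])

theorem quadForm_eq (Θ : Matrix (Fin 2) (Fin 2) ℂ) (μ ν : ℂ) : quadForm Θ μ ν =
    star μ * (Θ 0 0 * μ + Θ 0 1 * ν) + star ν * (Θ 1 0 * μ + Θ 1 1 * ν) := by
  simp [quadForm, dotProduct, mulVec, Fin.sum_univ_two]

theorem star_dotProduct_conjTranspose_mul_mul_mulVec {R : Type*} [CommSemiring R] [StarRing R]
    [Fintype n] (F G : Matrix p n R) (P : Matrix p p R) (a : n → R) :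
    star a ⬝ᵥ (Fᴴ * P * G) *ᵥ a = star (F *ᵥ a) ⬝ᵥ P *ᵥ (G *ᵥ a) := by
  rw [star_mulVec, ← mulVec_mulVec, ← mulVec_mulVec, dotProduct_mulVec _ Fᴴ]

theorem star_dotProduct_pencilForm_mulVec [Fintype n] (Θ : Matrix (Fin 2) (Fin 2) ℂ)
    {F G : Matrix p n ℂ} (P : Matrix p p ℂ) {a : n → ℂ} {y : p → ℂ} {μ ν : ℂ}
    (hF : F *ᵥ a = μ • y) (hG : G *ᵥ a = ν • y) :
    star a ⬝ᵥ pencilForm Θ F G P *ᵥ a = quadForm Θ μ ν * (star y ⬝ᵥ P *ᵥ y) := by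
  simp only [pencilForm_apply, add_mulVec, smul_mulVec, dotProduct_add, dotProduct_smul,
    star_dotProduct_conjTranspose_mul_mul_mulVec, hF, hG, star_smul, mulVec_smul, smul_dotProduct,
    smul_eq_mul, quadForm_eq]
  ring

/-- The matrix of the form `-2 Im (μ̄ ν)`, whose zeros `(μ, ν)` represent the points of the
extended real line. -/
def realLineForm : Matrix (Fin 2) (Fin 2) ℂ := !![0, Complex.I; -Complex.I, 0]

/-- The matrix of the form `-2 Re (μ̄ ν)`, which cuts out the nonnegative half of the extended
real line. -/
def halfLineForm : Matrix (Fin 2) (Fin 2) ℂ := !![0, -1; -1, 0]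

theorem isHermitian_realLineForm : realLineForm.IsHermitian := by
  ext i j
  fin_cases i <;> fin_cases j <;> simp [realLineForm]

theorem isHermitian_halfLineForm : halfLineForm.IsHermitian := by
  ext i j
  fin_cases i <;> fin_cases j <;> simp [halfLineForm]

theorem quadForm_realLineForm (t : ℝ) : quadForm realLineForm t 1 = 0 := by
  simp [quadForm_eq, realLineForm, mul_comm]

theorem quadForm_halfLineForm (t : ℝ) : quadForm halfLineForm t 1 = ((-2 * t : ℝ) : ℂ) := by
  simp only [quadForm_eq, halfLineForm, of_apply, cons_val', cons_val_zero, cons_val_one,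
    cons_val_fin_one, Complex.star_def, Complex.conj_ofReal, star_one]
  push_cast
  ring

theorem pencilForm_realLineForm (F G : Matrix p n ℂ) (P : Matrix p p ℂ) :
    pencilForm realLineForm F G P = Complex.I • (Fᴴ * P * G - Gᴴ * P * F) := by
  simp only [pencilForm_apply, realLineForm, of_apply, cons_val', cons_val_zero, cons_val_one,
    cons_val_fin_one, zero_smul]
  module

theorem pencilForm_halfLineForm (F G : Matrix p n ℂ) (Q : Matrix p p ℂ) :
    pencilForm halfLineForm F G Q = -(Fᴴ * Q * G + Gᴴ * Q * F) := by
  simp only [pencilForm_apply, halfLineForm, of_apply, cons_val', cons_val_zero, cons_val_one,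
    cons_val_fin_one, zero_smul]
  module

variable [Fintype n] {F G : Matrix p n ℂ}

theorem FullRowRank.eq_zero_of_pencilForm_realLineForm_eq_zero (h : FullRowRank F G)
    {P : Matrix p p ℂ} (hP : pencilForm realLineForm F G P = 0) : P = 0 := by
  rw [pencilForm_realLineForm, smul_eq_zero, or_iff_right Complex.I_ne_zero, sub_eq_zero] at hP
  refine h.eq_zero_of_mul_eq_zero (h.eq_zero_of_forall_mulVec_eq_zero fun t _ a ha => ?_)
  have hker : ((t : ℂ) • G - (1 : ℂ) • F)ᴴ *ᵥ ((P * G) *ᵥ a) = 0 := by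
    have hPa := congrArg (· *ᵥ a) hP
    simp only [← mulVec_mulVec, ha, mulVec_smul] at hPa
    simp [sub_mulVec, smul_mulVec, ← mulVec_mulVec, hPa]
  rw [← star_eq_zero]
  refine h.eq_zero_of_vecMul_eq_zero (μ := t) (ν := 1) (by simp) ?_
  rw [← star_inj, star_vecMul, star_star, hker, star_zero]

theorem FullRowRank.eq_zero_of_eq_pencilForm_add_pencilForm (h : FullRowRank F G)
    {T : Matrix n n ℂ} {P Q : Matrix p p ℂ} (hT : T.PosSemidef) (hQ : Q.PosSemidef)
    (hTPQ : T = pencilForm realLineForm F G P + pencilForm halfLineForm F G Q) :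
    T = 0 ∧ P = 0 ∧ Q = 0 := by
  have hzero (t : ℝ) (ht : 0 < t) (a) (ha : F *ᵥ a = (t : ℂ) • G *ᵥ a) :
      T *ᵥ a = 0 ∧ (Q * G) *ᵥ a = 0 := by
    have hTa := hT.dotProduct_mulVec_nonneg a
    have hQa := hQ.dotProduct_mulVec_nonneg (G *ᵥ a)
    have ht' : (0 : ℂ) < (2 * t : ℝ) := by exact_mod_cast (by positivity : 0 < 2 * t)
    have hform : star a ⬝ᵥ T *ᵥ a + (2 * t : ℝ) * (star (G *ᵥ a) ⬝ᵥ Q *ᵥ (G *ᵥ a)) = 0 := by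
      have hG : G *ᵥ a = (1 : ℂ) • G *ᵥ a := (one_smul _ _).symm
      rw [hTPQ, add_mulVec, dotProduct_add, star_dotProduct_pencilForm_mulVec _ _ ha hG,
        star_dotProduct_pencilForm_mulVec _ _ ha hG, quadForm_realLineForm,
        quadForm_halfLineForm]
      push_cast
      ring
    obtain ⟨hT0, hQ0⟩ := (add_eq_zero_iff_of_nonneg hTa (mul_nonneg ht'.le hQa)).1 hform
    rw [← mulVec_mulVec]
    exact ⟨(hT.dotProduct_mulVec_zero_iff a).1 hT0,
      (hQ.dotProduct_mulVec_zero_iff _).1 ((mul_eq_zero.1 hQ0).resolve_left ht'.ne')⟩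
  have hT0 : T = 0 := h.eq_zero_of_forall_mulVec_eq_zero fun t ht a ha => (hzero t ht a ha).1
  have hQ0 : Q = 0 := h.eq_zero_of_mul_eq_zero
    (h.eq_zero_of_forall_mulVec_eq_zero fun t ht a ha => (hzero t ht a ha).2)
  rw [hT0, hQ0, map_zero, add_zero] at hTPQ
  exact ⟨hT0, h.eq_zero_of_pencilForm_realLineForm_eq_zero hTPQ.symm, hQ0⟩

end Multipliers

section Duality

variable {p n : Type*} [Fintype p]

theorem trace_mul_mul_mul {R m k : Type*} [CommSemiring R] [Fintype m] [Fintype n] [Fintype k]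
    (X : Matrix m n R) (A : Matrix n k R) (P : Matrix k p R) (B : Matrix p m R) :
    (X * (A * P * B)).trace = (B * X * A * P).trace := by
  rw [trace_mul_comm, Matrix.mul_assoc, trace_mul_comm, ← Matrix.mul_assoc, trace_mul_comm,
    ← Matrix.mul_assoc, ← Matrix.mul_assoc]

theorem conjTranspose_mul_mul_conjTranspose_of_isHermitian {R k m : Type*} [Semiring R]
    [StarRing R] [Fintype n] {X : Matrix n n R} (hX : X.IsHermitian) (F : Matrix k n R)
    (G : Matrix m n R) :
    (F * X * Gᴴ)ᴴ = G * X * Fᴴ := by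
  rw [conjTranspose_mul, conjTranspose_mul, conjTranspose_conjTranspose, hX.eq, Matrix.mul_assoc]

/-- The real linear map `(T, P, Q) ↦ T - [F; G]ᴴ (Φ ⊗ P + Ψ ⊗ Q) [F; G]` for the forms `Φ`, `Ψ` of
the half-line: it sends the triples with `T` positive semidefinite to the matrices for which `P`
and `Q` are multipliers. -/
noncomputable def certificateMap (F G : Matrix p n ℂ) :
    Matrix n n ℂ × Matrix p p ℂ × Matrix p p ℂ →ₗ[ℝ] Matrix n n ℂ :=
  .fst ℝ _ _
    - (pencilForm realLineForm F G).restrictScalars ℝ ∘ₗ .fst ℝ _ _ ∘ₗ .snd ℝ _ _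
    - (pencilForm halfLineForm F G).restrictScalars ℝ ∘ₗ .snd ℝ _ _ ∘ₗ .snd ℝ _ _

theorem certificateMap_apply (F G : Matrix p n ℂ) (T : Matrix n n ℂ) (P Q : Matrix p p ℂ) :
    certificateMap F G (T, P, Q)
      = T - pencilForm realLineForm F G P - pencilForm halfLineForm F G Q :=
  rfl

/-- The cone of the triples `(T, P, Q)` with `T` positive semidefinite, `P` Hermitian and `Q ∈ 𝒬`.
The half-line needs all positive semidefinite `Q`, the whole line only `Q = 0`. -/
noncomputable def certificateCone {p : Type*} (n : Type*) [Fintype n]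
    (𝒬 : ProperCone ℝ (Matrix p p ℂ)) :
    ProperCone ℝ (Matrix n n ℂ × Matrix p p ℂ × Matrix p p ℂ) :=
  (posSemidefCone n).comap (.fst ℝ _ _) ⊓ (hermitianCone p).comap (.fst ℝ _ _ ∘L .snd ℝ _ _)
    ⊓ 𝒬.comap (.snd ℝ _ _ ∘L .snd ℝ _ _)

theorem mem_certificateCone {p : Type*} [Fintype n] {𝒬 : ProperCone ℝ (Matrix p p ℂ)}
    {T : Matrix n n ℂ} {P Q : Matrix p p ℂ} :
    (T, P, Q) ∈ certificateCone n 𝒬 ↔ T.PosSemidef ∧ P.IsHermitian ∧ Q ∈ 𝒬 :=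
  and_assoc

variable [Fintype n] {F G : Matrix p n ℂ} {𝒬 : ProperCone ℝ (Matrix p p ℂ)}

open scoped Matrix.Norms.Elementwise in
theorem isClosed_image_certificateCone (h : FullRowRank F G) (h𝒬 : ∀ Q ∈ 𝒬, Q.PosSemidef) :
    IsClosed (certificateMap F G '' certificateCone n 𝒬) := by
  refine isClosed_image_of_forall_eq_zero (C := certificateCone n 𝒬)
    (L := LinearMap.toContinuousLinearMap (certificateMap F G)) ?_
  rintro ⟨T, P, Q⟩ hx h0
  obtain ⟨hT, -, hQ⟩ := mem_certificateCone.1 hx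
  obtain ⟨rfl, rfl, rfl⟩ := h.eq_zero_of_eq_pencilForm_add_pencilForm hT (h𝒬 Q hQ)
    (sub_eq_zero.1 ((sub_sub _ _ _).symm.trans h0))
  rfl

theorem exists_isHermitian_forall_certificate_nonneg (h : FullRowRank F G)
    (h𝒬 : ∀ Q ∈ 𝒬, Q.PosSemidef) {M : Matrix n n ℂ} (hM : M.IsHermitian)
    (hcert : ¬ ∃ P Q, P.IsHermitian ∧ Q ∈ 𝒬 ∧
      (M + pencilForm realLineForm F G P + pencilForm halfLineForm F G Q).PosSemidef) :
    ∃ X : Matrix n n ℂ, X.IsHermitian ∧ (X * M).trace.re < 0 ∧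
      ∀ T P Q, T.PosSemidef → P.IsHermitian → Q ∈ 𝒬 →
        0 ≤ (X * (T - pencilForm realLineForm F G P - pencilForm halfLineForm F G Q)).trace.re := by
  let K : ProperCone ℝ (Matrix n n ℂ) :=
    ⟨(certificateCone n 𝒬).toPointedCone.map (certificateMap F G),
      isClosed_image_certificateCone h h𝒬⟩
  have hKherm : ∀ H ∈ K, H.IsHermitian := by
    rintro _ ⟨⟨T, P, Q⟩, hx, rfl⟩
    obtain ⟨hT, hP, hQ⟩ := mem_certificateCone.1 hx
    exact (hT.isHermitian.sub (isHermitian_pencilForm isHermitian_realLineForm F G hP)).sub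
      (isHermitian_pencilForm isHermitian_halfLineForm F G (h𝒬 Q hQ).isHermitian)
  have hMK : M ∉ K := by
    rintro ⟨⟨T, P, Q⟩, hx, rfl⟩
    obtain ⟨hT, hP, hQ⟩ := mem_certificateCone.1 hx
    refine hcert ⟨P, Q, hP, hQ, ?_⟩
    convert hT using 1
    change certificateMap F G (T, P, Q) + _ + _ = T
    rw [certificateMap_apply]
    abel
  obtain ⟨X, hX, hXK, hXM⟩ := exists_isHermitian_re_trace_mul_neg hKherm hM hMK
  exact ⟨X, hX, hXM, fun T P Q hT hP hQ =>
    hXK _ ⟨(T, P, Q), mem_certificateCone.2 ⟨hT, hP, hQ⟩, rfl⟩⟩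

theorem trace_mul_pencilForm_realLineForm (X : Matrix n n ℂ) (P : Matrix p p ℂ) :
    (X * pencilForm realLineForm F G P).trace
      = (Complex.I • (G * X * Fᴴ - F * X * Gᴴ) * P).trace := by
  rw [pencilForm_realLineForm]
  simp only [Matrix.mul_smul, Matrix.smul_mul, trace_smul, Matrix.mul_sub, Matrix.sub_mul,
    trace_sub, trace_mul_mul_mul]

theorem isHermitian_of_forall_re_trace_mul_pencilForm_nonpos {X : Matrix n n ℂ}
    (hX : X.IsHermitian)
    (h : ∀ P, P.IsHermitian → (X * pencilForm realLineForm F G P).trace.re ≤ 0) :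
    (F * X * Gᴴ).IsHermitian := by
  set S := F * X * Gᴴ with hS
  have hSstar : G * X * Fᴴ = Sᴴ :=
    (conjTranspose_mul_mul_conjTranspose_of_isHermitian hX F G).symm
  have hD : (Complex.I • (Sᴴ - S)).IsHermitian := by
    rw [IsHermitian, conjTranspose_smul, conjTranspose_sub, conjTranspose_conjTranspose,
      Complex.star_def, Complex.conj_I]
    module
  have hle := h _ hD
  rw [trace_mul_pencilForm_realLineForm, hSstar, ← hS] at hle
  nth_rw 1 [← hD.eq] at hle
  have hge := Complex.nonneg_iff.1
    (posSemidef_conjTranspose_mul_self (Complex.I • (Sᴴ - S))).trace_nonneg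
  have hD0 := trace_conjTranspose_mul_self_eq_zero_iff.1
    (Complex.ext (hle.antisymm hge.1) hge.2.symm)
  exact sub_eq_zero.1 ((smul_eq_zero.1 hD0).resolve_left Complex.I_ne_zero)

theorem exists_posSemidef_re_trace_mul_neg (h : FullRowRank F G)
    (h𝒬 : ∀ Q ∈ 𝒬, Q.PosSemidef) {M : Matrix n n ℂ} (hM : M.IsHermitian)
    (hcert : ¬ ∃ P Q, P.IsHermitian ∧ Q ∈ 𝒬 ∧
      (M + pencilForm realLineForm F G P + pencilForm halfLineForm F G Q).PosSemidef) :
    ∃ X : Matrix n n ℂ, X.PosSemidef ∧ (F * X * Gᴴ).IsHermitian ∧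
      (∀ Q ∈ 𝒬, 0 ≤ (F * X * Gᴴ * Q).trace.re) ∧ (M * X).trace.re < 0 := by
  obtain ⟨X, hX, hXM, hcone⟩ := exists_isHermitian_forall_certificate_nonneg h h𝒬 hM hcert
  have hS : (F * X * Gᴴ).IsHermitian :=
    isHermitian_of_forall_re_trace_mul_pencilForm_nonpos hX fun P hP => by
      simpa using hcone 0 P 0 .zero hP 𝒬.zero_mem
  refine ⟨X, posSemidef_iff_re_nonneg.2 ⟨hX, fun v => ?_⟩, hS, fun Q hQ => ?_, ?_⟩
  · simpa [trace_mul_vecMulVec] using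
      hcone _ 0 0 (posSemidef_vecMulVec_self_star v) isHermitian_zero 𝒬.zero_mem
  · have hQS := hcone 0 0 Q .zero isHermitian_zero hQ
    have hSstar : G * X * Fᴴ = F * X * Gᴴ :=
      (conjTranspose_mul_mul_conjTranspose_of_isHermitian hX F G).symm.trans hS
    rw [map_zero, sub_zero, zero_sub, pencilForm_halfLineForm, neg_neg, Matrix.mul_add, trace_add,
      trace_mul_mul_mul, trace_mul_mul_mul, hSstar, Complex.add_re] at hQS
    linarith
  · rwa [trace_mul_comm]

end Duality

section RankOne

variable {p n : Type*} [Fintype p] [Fintype n]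

theorem exists_mul_eq_mul_diagonal_eigenvalues [DecidableEq n] {Λ : Matrix n n ℂ}
    (hΛ : Λ.IsHermitian) : ∃ U : Matrix n n ℂ, U * Uᴴ = 1 ∧
      Λ * U = U * diagonal (fun k => (hΛ.eigenvalues k : ℂ)) := by
  obtain ⟨hU, hU'⟩ := Unitary.mem_iff.1 hΛ.eigenvectorUnitary.2
  refine ⟨hΛ.eigenvectorUnitary, hU', ?_⟩
  have hspec := hΛ.spectral_theorem
  rw [Unitary.conjStarAlgAut_apply] at hspec
  exact (congrArg (· * _) hspec).trans (by rw [Matrix.mul_assoc, hU, Matrix.mul_one]; rfl)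

theorem exists_eq_mul_conjTranspose_mul_eq_mul_diagonal [DecidableEq p] [DecidableEq n]
    {F G : Matrix p n ℂ} {X : Matrix n n ℂ} (hX : X.PosSemidef) (hN : (F * X * Gᴴ).IsHermitian)
    (hdet : IsUnit (F * X * Gᴴ).det) :
    ∃ (A : Matrix n n ℂ) (t : n → ℝ), X = A * Aᴴ ∧ F * A = G * A * diagonal (fun k => (t k : ℂ)) ∧
      ((F * X * Gᴴ).PosSemidef → ∀ k, 0 ≤ t k) := by
  obtain ⟨V, rfl⟩ : ∃ V : Matrix n n ℂ, X = V * Vᴴ := by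
    open scoped MatrixOrder Matrix.Norms.L2Operator in
    exact CStarAlgebra.nonneg_iff_eq_mul_star_self.1 (nonneg_iff_posSemidef.2 hX)
  set N := F * (V * Vᴴ) * Gᴴ with hNdef
  have hGVF : G * V * (F * V)ᴴ = N := by
    rw [← hN.eq, hNdef, conjTranspose_mul_mul_conjTranspose_of_isHermitian hX.isHermitian,
      conjTranspose_mul]
    simp only [Matrix.mul_assoc]
  -- The reals `t` are the eigenvalues of a Hermitian solution `Λ` of `G V Λ = F V`.
  obtain ⟨Λ, hΛ, hGVΛ, hΛpos⟩ : ∃ Λ : Matrix n n ℂ, Λ.IsHermitian ∧ G * V * Λ = F * V ∧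
      (N.PosSemidef → Λ.PosSemidef) := by
    refine ⟨(F * V)ᴴ * N⁻¹ * (F * V), isHermitian_conjTranspose_mul_mul _ hN.inv, ?_,
      fun hpos => hpos.inv.conjTranspose_mul_mul_same _⟩
    rw [← Matrix.mul_assoc (G * V), ← Matrix.mul_assoc (G * V), hGVF, mul_nonsing_inv _ hdet,
      Matrix.one_mul]
  obtain ⟨U, hU, hΛU⟩ := exists_mul_eq_mul_diagonal_eigenvalues hΛ
  refine ⟨V * U, hΛ.eigenvalues, ?_, ?_, fun hpos => (hΛpos hpos).eigenvalues_nonneg⟩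
  · rw [conjTranspose_mul, Matrix.mul_assoc, ← Matrix.mul_assoc U, hU, Matrix.one_mul]
  · rw [← Matrix.mul_assoc, ← hGVΛ, Matrix.mul_assoc, hΛU]
    simp only [Matrix.mul_assoc]

theorem FullRowRank.exists_posSemidef_posDef {F G : Matrix p n ℂ} (h : FullRowRank F G) :
    ∃ X : Matrix n n ℂ, X.PosSemidef ∧ (F * X * Gᴴ).PosDef := by
  classical
  obtain ⟨b, hb, hspan, hli⟩ := exists_linearIndependent ℂ
    {a : n → ℂ | ∃ t : ℝ, 0 < t ∧ F *ᵥ a = (t : ℂ) • G *ᵥ a}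
  have := hli.setFinite.fintype
  choose t ht hFt using fun a : b => hb a.2
  let A : Matrix n b ℂ := of fun i a => (a : n → ℂ) i
  have hFA : F * A = G * A * diagonal (fun a => (t a : ℂ)) := by
    ext i a
    rw [mul_diagonal, mul_comm]
    exact congrFun (hFt a) i
  have hinj : Function.Injective fun z => z ᵥ* (G * A) := by
    refine (injective_iff_map_eq_zero (vecMulLinear (G * A))).2 fun z hz => ?_
    have hker : LinearMap.ker (dotProductBilin ℂ ℂ (z ᵥ* G)) = ⊤ := by
      rw [← top_le_iff, ← h.span_eq_top, ← hspan, Submodule.span_le]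
      intro a ha
      exact (congrFun (vecMul_vecMul z G A) ⟨a, ha⟩).trans (congrFun hz ⟨a, ha⟩)
    refine h.eq_zero_of_vecMul_eq_zero (μ := 1) (ν := 0) (by simp) ?_
    rw [one_smul, zero_smul, sub_zero]
    exact dotProduct_eq_zero _ fun a => LinearMap.congr_fun (LinearMap.ker_eq_top.1 hker) a
  refine ⟨A * Aᴴ, posSemidef_self_mul_conjTranspose A, ?_⟩
  have hN : F * (A * Aᴴ) * Gᴴ = G * A * diagonal (fun a => (t a : ℂ)) * (G * A)ᴴ := by
    rw [← hFA, conjTranspose_mul]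
    simp only [Matrix.mul_assoc]
  rw [hN]
  exact (PosDef.diagonal fun a => by exact_mod_cast ht a).mul_mul_conjTranspose_same hinj

theorem re_trace_mul_nonneg_of_isUnit_det [DecidableEq p] {F G : Matrix p n ℂ}
    {M X : Matrix n n ℂ} (hX : X.PosSemidef) (hN : (F * X * Gᴴ).IsHermitian)
    (hdet : IsUnit (F * X * Gᴴ).det)
    (hM : ∀ t : ℝ, ((F * X * Gᴴ).PosSemidef → 0 ≤ t) → ∀ a, F *ᵥ a = (t : ℂ) • G *ᵥ a →
      0 ≤ (star a ⬝ᵥ M *ᵥ a).re) :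
    0 ≤ (M * X).trace.re := by
  classical
  obtain ⟨A, t, hXA, hFA, ht⟩ := exists_eq_mul_conjTranspose_mul_eq_mul_diagonal hX hN hdet
  have htrace : (M * X).trace = ∑ k, star (A.col k) ⬝ᵥ M *ᵥ A.col k := by
    rw [hXA, ← Matrix.mul_assoc, trace_mul_comm]
    rfl
  rw [htrace, Complex.re_sum]
  refine Finset.sum_nonneg fun k _ => hM (t k) (fun hpos => ht hpos k) _ ?_
  ext i
  exact (congrFun₂ hFA i k).trans ((mul_diagonal _ _ _ _).trans (mul_comm _ _))

open Filter Topology in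
theorem eventually_isUnit_det_add_smul [DecidableEq p] (N : Matrix p p ℂ) {N₀ : Matrix p p ℂ}
    (hN₀ : IsUnit N₀.det) : ∀ᶠ ε : ℝ in 𝓝[>] 0, IsUnit (N + (ε : ℂ) • N₀).det := by
  have hroots : {z : ℂ | (-(N₀⁻¹ * N)).charpoly.IsRoot z}.Finite :=
    Polynomial.finite_setOfPred_isRoot (charpoly_monic _).ne_zero
  have hev : ∀ᶠ ε : ℝ in 𝓝[>] 0, ¬ (-(N₀⁻¹ * N)).charpoly.IsRoot (ε : ℂ) :=
    (hroots.preimage Complex.ofReal_injective.injOn).eventually_cofinite_notMem.filter_mono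
      ((nhdsGT_le_nhdsNE 0).trans (nhdsNE_le_cofinite 0))
  filter_upwards [hev] with ε hε
  have hfactor : N + (ε : ℂ) • N₀ = N₀ * (scalar p (ε : ℂ) - -(N₀⁻¹ * N)) := by
    rw [sub_neg_eq_add, Matrix.mul_add, ← Matrix.mul_assoc, mul_nonsing_inv _ hN₀, Matrix.one_mul,
      add_comm, scalar_apply, ← smul_one_eq_diagonal, Matrix.mul_smul, Matrix.mul_one]
  rw [hfactor, det_mul, ← eval_charpoly]
  exact hN₀.mul (isUnit_iff_ne_zero.2 hε)

open Filter Topology in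
theorem FullRowRank.re_trace_mul_nonneg {F G : Matrix p n ℂ} (h : FullRowRank F G)
    {M X : Matrix n n ℂ} (hX : X.PosSemidef) (hN : (F * X * Gᴴ).IsHermitian)
    (hM : ∀ t : ℝ, ((F * X * Gᴴ).PosSemidef → 0 ≤ t) → ∀ a, F *ᵥ a = (t : ℂ) • G *ᵥ a →
      0 ≤ (star a ⬝ᵥ M *ᵥ a).re) :
    0 ≤ (M * X).trace.re := by
  classical
  obtain ⟨X₀, hX₀, hN₀⟩ := h.exists_posSemidef_posDef
  have hlin (ε : ℝ) : F * (X + (ε : ℂ) • X₀) * Gᴴ = F * X * Gᴴ + (ε : ℂ) • (F * X₀ * Gᴴ) := by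
    simp only [Matrix.mul_add, Matrix.add_mul, Matrix.mul_smul, Matrix.smul_mul]
  have hev : ∀ᶠ ε : ℝ in 𝓝[>] 0, 0 ≤ (M * X).trace.re + ε * (M * X₀).trace.re := by
    filter_upwards [eventually_isUnit_det_add_smul (F * X * Gᴴ)
      ((isUnit_iff_isUnit_det _).1 hN₀.isUnit), self_mem_nhdsWithin] with ε hdet (hε : 0 < ε)
    have hε' : (0 : ℂ) ≤ ε := by exact_mod_cast hε.le
    have hpsd : ((ε : ℂ) • (F * X₀ * Gᴴ)).PosSemidef := hN₀.posSemidef.smul hε'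
    rw [← hlin] at hdet
    have htrace := re_trace_mul_nonneg_of_isUnit_det (hX.add (hX₀.smul hε'))
      (hlin ε ▸ hN.add hpsd.isHermitian) hdet
      fun t ht => hM t fun hpos => ht (hlin ε ▸ hpos.add hpsd)
    simpa [Matrix.mul_add, trace_add, trace_smul] using htrace
  have hlim : Tendsto (fun ε : ℝ => (M * X).trace.re + ε * (M * X₀).trace.re) (𝓝[>] 0)
      (𝓝 ((M * X).trace.re + 0 * (M * X₀).trace.re)) :=
    tendsto_nhdsWithin_of_tendsto_nhds (Continuous.tendsto (by fun_prop) 0)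
  rw [zero_mul, add_zero] at hlim
  exact ge_of_tendsto hlim hev

end RankOne

section Curve

variable {Φ Ψ Θ : Matrix (Fin 2) (Fin 2) ℂ}

theorem quadForm_conjTranspose_mul_mul (S Θ : Matrix (Fin 2) (Fin 2) ℂ) (μ ν : ℂ) :
    quadForm (Sᴴ * Θ * S) μ ν = quadForm Θ (S 0 0 * μ + S 0 1 * ν) (S 1 0 * μ + S 1 1 * ν) := by
  simp only [quadForm_eq, mul_apply, Fin.sum_univ_two, conjTranspose_apply, star_add, star_mul']
  ring

theorem quadForm_mul_mul (Θ : Matrix (Fin 2) (Fin 2) ℂ) (s μ ν : ℂ) :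
    quadForm Θ (s * μ) (s * ν) = Complex.normSq s * quadForm Θ μ ν := by
  rw [← Complex.mul_conj, ← Complex.star_def]
  simp only [quadForm_eq, star_mul']
  ring

theorem smul_mem_curve {s : ℂ} (hs : s ≠ 0) {c : ℂ × ℂ} (hc : c ∈ curve Φ Ψ) :
    s • c ∈ curve Φ Ψ := by
  obtain ⟨hc0, hΦc, hΨc⟩ := hc
  refine ⟨smul_ne_zero hs hc0, ?_, ?_⟩
  · simp only [Prod.smul_fst, Prod.smul_snd, smul_eq_mul, quadForm_mul_mul, hΦc, mul_zero]
  · simp only [Prod.smul_fst, Prod.smul_snd, smul_eq_mul, quadForm_mul_mul, Complex.re_ofReal_mul]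
    exact mul_nonpos_of_nonneg_of_nonpos (Complex.normSq_nonneg s) hΨc

theorem mem_dict_of_mulVec_eq_ofReal_smul {p n : Type*} [Fintype n] {F G : Matrix p n ℂ} {t : ℝ}
    {a : n → ℂ} (ha : F *ᵥ a = (t : ℂ) • G *ᵥ a) (hΦ : quadForm Φ t 1 = 0)
    (hΨ : (quadForm Ψ t 1).re ≤ 0) : a ∈ dict Φ Ψ F G := by
  refine ⟨((t : ℂ), 1), ⟨by simp, hΦ, hΨ⟩, ?_⟩
  simp only [sub_mulVec, smul_mulVec, one_smul, ha, sub_self]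

theorem quadForm_ofReal_re (hΘ : Θ.IsHermitian) (μ ν : ℂ) :
    ((quadForm Θ μ ν).re : ℂ) = quadForm Θ μ ν :=
  Complex.ext rfl (hΘ.im_star_dotProduct_mulVec_self ![μ, ν]).symm

theorem conjTranspose_mul_mul_eq_of_isHermitian (hΘ : Θ.IsHermitian) (c d : ℂ × ℂ) :
    !![c.1, d.1; c.2, d.2]ᴴ * Θ * !![c.1, d.1; c.2, d.2] =
      !![quadForm Θ c.1 c.2, star ![c.1, c.2] ⬝ᵥ Θ *ᵥ ![d.1, d.2];
        star (star ![c.1, c.2] ⬝ᵥ Θ *ᵥ ![d.1, d.2]), quadForm Θ d.1 d.2] := by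
  have hstar (i j) : star (Θ i j) = Θ j i := hΘ.apply j i
  ext i j
  fin_cases i <;> fin_cases j <;>
    simp only [quadForm, mul_apply, dotProduct, mulVec, Fin.sum_univ_two, conjTranspose_apply,
      Pi.star_apply, star_add, star_mul', star_star, hstar, of_apply, cons_val', cons_val_zero,
      cons_val_one, cons_val_fin_one, Fin.zero_eta, Fin.mk_one, Fin.isValue] <;>
    ring

theorem exists_mem_curve_pairing_eq_I (hΦ : Φ.IsHermitian) (hdet : Φ.det ≠ 0)
    (hcurve : CurveNontrivial Φ Ψ) : ∃ c ∈ curve Φ Ψ, ∃ d ∈ curve Φ Ψ,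
      c.1 * d.2 - d.1 * c.2 ≠ 0 ∧ star ![c.1, c.2] ⬝ᵥ Φ *ᵥ ![d.1, d.2] = Complex.I := by
  obtain ⟨c, hc, d, hd, hcd⟩ := hcurve
  set φ := star ![c.1, c.2] ⬝ᵥ Φ *ᵥ ![d.1, d.2] with hφdef
  have hφ : φ ≠ 0 := by
    intro hφ0
    have hdetS := congrArg det (conjTranspose_mul_mul_eq_of_isHermitian hΦ c d)
    rw [← hφdef, hφ0, hc.2.1, det_mul, det_mul, det_conjTranspose, det_fin_two_of,
      det_fin_two_of] at hdetS
    simp only [star_zero, mul_zero, zero_mul, sub_zero, mul_eq_zero, star_eq_zero, hdet,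
      sub_ne_zero.2 hcd, or_self] at hdetS
  have hw : Complex.I / φ ≠ 0 := div_ne_zero Complex.I_ne_zero hφ
  refine ⟨c, hc, (Complex.I / φ) • d, smul_mem_curve hw hd, ?_, ?_⟩
  · convert mul_ne_zero hw (sub_ne_zero.2 hcd) using 1
    simp only [Prod.smul_fst, Prod.smul_snd, smul_eq_mul]
    ring
  · have hvec : ![((Complex.I / φ) • d).1, ((Complex.I / φ) • d).2]
        = (Complex.I / φ) • ![d.1, d.2] := by
      simp
    rw [hvec, mulVec_smul, dotProduct_smul, smul_eq_mul, ← hφdef, div_mul_cancel₀ _ hφ]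

theorem exists_normalForm (hΦ : Φ.IsHermitian) (hΨ : Ψ.IsHermitian) (hdet : Φ.det ≠ 0)
    (hcurve : CurveNontrivial Φ Ψ) : ∃ S : Matrix (Fin 2) (Fin 2) ℂ, S.det ≠ 0 ∧
      Sᴴ * Φ * S = realLineForm ∧ ∃ α β γ κ : ℝ, α ≤ 0 ∧ γ ≤ 0 ∧
        Sᴴ * Ψ * S - (κ : ℂ) • realLineForm = !![(α : ℂ), β; β, γ] := by
  obtain ⟨c, hc, d, hd, hcd, hφ⟩ := exists_mem_curve_pairing_eq_I hΦ hdet hcurve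
  refine ⟨!![c.1, d.1; c.2, d.2], by rwa [det_fin_two_of], ?_, (quadForm Ψ c.1 c.2).re,
    (star ![c.1, c.2] ⬝ᵥ Ψ *ᵥ ![d.1, d.2]).re, (quadForm Ψ d.1 d.2).re,
    (star ![c.1, c.2] ⬝ᵥ Ψ *ᵥ ![d.1, d.2]).im, hc.2.2, hd.2.2, ?_⟩
  · rw [conjTranspose_mul_mul_eq_of_isHermitian hΦ, hφ, hc.2.1, hd.2.1, realLineForm,
      Complex.star_def, Complex.conj_I]
  · rw [conjTranspose_mul_mul_eq_of_isHermitian hΨ, quadForm_ofReal_re hΨ, quadForm_ofReal_re hΨ]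
    generalize star ![c.1, c.2] ⬝ᵥ Ψ *ᵥ ![d.1, d.2] = ψ
    ext i j
    fin_cases i <;> fin_cases j <;> simp [realLineForm, Complex.ext_iff]

end Curve

section PencilCongr

variable {p n : Type*} {S : Matrix (Fin 2) (Fin 2) ℂ} {F G : Matrix p n ℂ}

theorem pencilForm_conjTranspose_mul_mul [Fintype p] (S Θ : Matrix (Fin 2) (Fin 2) ℂ)
    (F G : Matrix p n ℂ) (P : Matrix p p ℂ) :
    pencilForm (Sᴴ * Θ * S) F G P
      = pencilForm Θ (S 0 0 • F + S 0 1 • G) (S 1 0 • F + S 1 1 • G) P := by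
  simp only [pencilForm_apply, mul_apply, Fin.sum_univ_two, conjTranspose_apply,
    conjTranspose_add, conjTranspose_smul, Matrix.add_mul, Matrix.mul_add, Matrix.smul_mul,
    Matrix.mul_smul]
  module

theorem smul_sub_smul_congr (S : Matrix (Fin 2) (Fin 2) ℂ) (F G : Matrix p n ℂ) (μ ν : ℂ) :
    (S 0 0 * μ + S 0 1 * ν) • (S 1 0 • F + S 1 1 • G)
      - (S 1 0 * μ + S 1 1 * ν) • (S 0 0 • F + S 0 1 • G) = S.det • (μ • G - ν • F) := by
  rw [det_fin_two]
  module

theorem congr_pair_ne_zero (hS : S.det ≠ 0) {μ ν : ℂ} (h : (μ, ν) ≠ 0) :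
    (S 0 0 * μ + S 0 1 * ν, S 1 0 * μ + S 1 1 * ν) ≠ 0 := by
  contrapose! h
  obtain ⟨h₁, h₂⟩ := Prod.mk_eq_zero.1 h
  have hmulVec : S *ᵥ ![μ, ν] = 0 := by
    ext i
    fin_cases i
    · simpa [mulVec, dotProduct, Fin.sum_univ_two] using h₁
    · simpa [mulVec, dotProduct, Fin.sum_univ_two] using h₂
  have hzero := eq_zero_of_mulVec_eq_zero hS hmulVec
  exact Prod.mk_eq_zero.2 ⟨congrFun hzero 0, congrFun hzero 1⟩

theorem exists_eq_congr (hS : S.det ≠ 0) (F G : Matrix p n ℂ) : ∃ F' G' : Matrix p n ℂ,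
    F = S 0 0 • F' + S 0 1 • G' ∧ G = S 1 0 • F' + S 1 1 • G' := by
  refine ⟨S.det⁻¹ • (S 1 1 • F - S 0 1 • G), S.det⁻¹ • (S 0 0 • G - S 1 0 • F), ?_, ?_⟩
  · conv_lhs => rw [← inv_smul_smul₀ hS F]
    rw [det_fin_two]
    module
  · conv_lhs => rw [← inv_smul_smul₀ hS G]
    rw [det_fin_two]
    module

variable [Fintype n]

theorem FullRowRank.of_congr [Fintype p] (hS : S.det ≠ 0)
    (h : FullRowRank (S 0 0 • F + S 0 1 • G) (S 1 0 • F + S 1 1 • G)) : FullRowRank F G := by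
  intro μ ν hμν
  rw [← h _ _ (congr_pair_ne_zero hS hμν), smul_sub_smul_congr,
    rank_smul_of_mem_nonZeroDivisors _ (mem_nonZeroDivisors_of_ne_zero hS)]

theorem mem_dict_of_congr {Φ Ψ : Matrix (Fin 2) (Fin 2) ℂ} (hS : S.det ≠ 0) {a : n → ℂ}
    (ha : a ∈ dict (Sᴴ * Φ * S) (Sᴴ * Ψ * S) F G) :
    a ∈ dict Φ Ψ (S 0 0 • F + S 0 1 • G) (S 1 0 • F + S 1 1 • G) := by
  obtain ⟨c, ⟨hc0, hΦc, hΨc⟩, hca⟩ := ha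
  rw [quadForm_conjTranspose_mul_mul] at hΦc hΨc
  refine ⟨(S 0 0 * c.1 + S 0 1 * c.2, S 1 0 * c.1 + S 1 1 * c.2),
    ⟨congr_pair_ne_zero hS hc0, hΦc, hΨc⟩, ?_⟩
  rw [smul_sub_smul_congr, smul_mulVec, hca, smul_zero]

end PencilCongr

section KYP

variable {p n : Type*} [Fintype p] [Fintype n]

/-- The linear matrix inequality of the generalized Kalman-Yakubovich-Popov lemma for the matrix
`M`: there are multipliers `P` and `Q` such that `M + [F; G]ᴴ (Φ ⊗ P + Ψ ⊗ Q) [F; G]` is positive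
semidefinite. -/
def HasMultipliers (Φ Ψ : Matrix (Fin 2) (Fin 2) ℂ) (F G : Matrix p n ℂ) (M : Matrix n n ℂ) :
    Prop :=
  ∃ P Q : Matrix p p ℂ, P.IsHermitian ∧ Q.PosSemidef ∧
    (M + pencilForm Φ F G P + pencilForm Ψ F G Q).PosSemidef

/-- The nontrivial half of the generalized Kalman-Yakubovich-Popov lemma for pencils of the given
size over the curve of `Φ` and `Ψ`. -/
def KYPProperty (p n : Type*) [Fintype p] [Fintype n] (Φ Ψ : Matrix (Fin 2) (Fin 2) ℂ) : Prop :=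
  ∀ F G : Matrix p n ℂ, FullRowRank F G → ∀ M : Matrix n n ℂ, M.IsHermitian →
    (∀ a ∈ dict Φ Ψ F G, 0 ≤ (star a ⬝ᵥ M *ᵥ a).re) → HasMultipliers Φ Ψ F G M

variable {Φ Ψ S : Matrix (Fin 2) (Fin 2) ℂ} {F G : Matrix p n ℂ} {M : Matrix n n ℂ}

theorem kypProperty_realLineForm (hΨ : ∀ t : ℝ, (quadForm Ψ t 1).re ≤ 0) :
    KYPProperty p n realLineForm Ψ := by
  intro F G hFG M hM hpos
  by_contra hmult
  obtain ⟨X, hX, hN, -, hMX⟩ := exists_posSemidef_re_trace_mul_neg (𝒬 := ⊥) hFG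
    (by rintro Q rfl; exact .zero) hM (by
      rintro ⟨P, Q, hP, rfl, hPQ⟩
      exact hmult ⟨P, 0, hP, .zero, by simpa only [map_zero] using hPQ⟩)
  refine hMX.not_ge (hFG.re_trace_mul_nonneg hX hN fun t _ a ha => hpos a ?_)
  exact mem_dict_of_mulVec_eq_ofReal_smul ha (quadForm_realLineForm t) (hΨ t)

theorem kypProperty_halfLineForm : KYPProperty p n realLineForm halfLineForm := by
  intro F G hFG M hM hpos
  by_contra hmult
  obtain ⟨X, hX, hN, hNQ, hMX⟩ := exists_posSemidef_re_trace_mul_neg (𝒬 := posSemidefCone p) hFG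
    (fun _ => id) hM (by
      rintro ⟨P, Q, hP, hQ, hPQ⟩
      exact hmult ⟨P, Q, hP, hQ, hPQ⟩)
  have hNpos : (F * X * Gᴴ).PosSemidef := by
    refine posSemidef_iff_re_nonneg.2 ⟨hN, fun z => ?_⟩
    simpa only [trace_mul_vecMulVec] using hNQ _ (posSemidef_vecMulVec_self_star z)
  refine hMX.not_ge (hFG.re_trace_mul_nonneg hX hN fun t ht a ha => hpos a ?_)
  refine mem_dict_of_mulVec_eq_ofReal_smul ha (quadForm_realLineForm t) ?_
  rw [quadForm_halfLineForm, Complex.ofReal_re]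
  linarith [ht hNpos]

theorem KYPProperty.of_congr (hS : S.det ≠ 0)
    (h : KYPProperty p n (Sᴴ * Φ * S) (Sᴴ * Ψ * S)) : KYPProperty p n Φ Ψ := by
  intro F G hFG M hM hpos
  obtain ⟨F, G, rfl, rfl⟩ := exists_eq_congr hS F G
  obtain ⟨P, Q, hP, hQ, hPQ⟩ := h F G (hFG.of_congr hS) M hM fun a ha =>
    hpos a (mem_dict_of_congr hS ha)
  exact ⟨P, Q, hP, hQ, by
    rwa [← pencilForm_conjTranspose_mul_mul, ← pencilForm_conjTranspose_mul_mul]⟩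

theorem quadForm_smul (k : ℂ) (Θ : Matrix (Fin 2) (Fin 2) ℂ) (μ ν : ℂ) :
    quadForm (k • Θ) μ ν = k * quadForm Θ μ ν := by
  rw [quadForm, smul_mulVec, dotProduct_smul, smul_eq_mul, quadForm]

theorem quadForm_sub (Θ Θ' : Matrix (Fin 2) (Fin 2) ℂ) (μ ν : ℂ) :
    quadForm (Θ - Θ') μ ν = quadForm Θ μ ν - quadForm Θ' μ ν := by
  rw [quadForm, sub_mulVec, dotProduct_sub, quadForm, quadForm]

theorem KYPProperty.of_linearCombination {δ k : ℝ} (κ : ℝ) (hδ : δ ≠ 0) (hk : 0 < k)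
    (h : KYPProperty p n ((δ : ℂ) • Φ) ((k : ℂ) • Ψ - (κ : ℂ) • Φ)) : KYPProperty p n Φ Ψ := by
  intro F G hFG M hM hpos
  obtain ⟨P, Q, hP, hQ, hPQ⟩ := h F G hFG M hM fun a ⟨c, ⟨hc, hΦc, hΨc⟩, hca⟩ => by
    have hΦ0 : quadForm Φ c.1 c.2 = 0 := by
      simpa only [quadForm_smul, mul_eq_zero, Complex.ofReal_eq_zero, hδ, false_or] using hΦc
    rw [quadForm_sub, quadForm_smul, quadForm_smul, hΦ0, mul_zero, sub_zero,
      Complex.re_ofReal_mul] at hΨc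
    exact hpos a ⟨c, ⟨hc, hΦ0, nonpos_of_mul_nonpos_right hΨc hk⟩, hca⟩
  refine ⟨(δ : ℂ) • P - (κ : ℂ) • Q, (k : ℂ) • Q, ?_, hQ.smul (by exact_mod_cast hk.le), ?_⟩
  · exact (hP.smul (Complex.conj_ofReal δ)).sub (hQ.isHermitian.smul (Complex.conj_ofReal κ))
  · convert hPQ using 1
    simp only [map_sub, map_smul, pencilForm_apply, Matrix.sub_apply, Matrix.smul_apply,
      smul_eq_mul]
    module

theorem conjTranspose_mul_realLineForm_mul (a b c d : ℝ) :
    !![(a : ℂ), b; c, d]ᴴ * realLineForm * !![(a : ℂ), b; c, d]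
      = ((a * d - b * c : ℝ) : ℂ) • realLineForm := by
  ext i j
  fin_cases i <;> fin_cases j <;>
    simp [realLineForm, mul_apply, Fin.sum_univ_two] <;> ring

theorem conjTranspose_mul_ofReal_mul (α β γ a b c d : ℝ) :
    !![(a : ℂ), b; c, d]ᴴ * !![(α : ℂ), β; β, γ] * !![(a : ℂ), b; c, d]
      = !![((α * a ^ 2 + 2 * β * a * c + γ * c ^ 2 : ℝ) : ℂ),
            ((α * a * b + β * (a * d + b * c) + γ * c * d : ℝ) : ℂ);
          ((α * a * b + β * (a * d + b * c) + γ * c * d : ℝ) : ℂ),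
            ((α * b ^ 2 + 2 * β * b * d + γ * d ^ 2 : ℝ) : ℂ)] := by
  ext i j
  fin_cases i <;> fin_cases j <;> simp [mul_apply, Fin.sum_univ_two] <;> ring

theorem kypProperty_of_isotropic {α β γ a b c d k : ℝ} (hdet : a * d - b * c ≠ 0) (hk : 0 < k)
    (hac : α * a ^ 2 + 2 * β * a * c + γ * c ^ 2 = 0)
    (hbd : α * b ^ 2 + 2 * β * b * d + γ * d ^ 2 = 0)
    (hpair : α * a * b + β * (a * d + b * c) + γ * c * d = -k) :
    KYPProperty p n realLineForm !![(α : ℂ), β; β, γ] := by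
  refine .of_congr (S := !![(a : ℂ), b; c, d]) ?_ ?_
  · rw [det_fin_two_of]
    exact_mod_cast hdet
  · have hhalf : !![((0 : ℝ) : ℂ), ((-k : ℝ) : ℂ); ((-k : ℝ) : ℂ), ((0 : ℝ) : ℂ)]
        = (k : ℂ) • halfLineForm := by
      simp [halfLineForm]
    rw [conjTranspose_mul_ofReal_mul, hac, hbd, hpair, hhalf, conjTranspose_mul_realLineForm_mul]
    refine .of_linearCombination 0 (inv_ne_zero hdet) (inv_pos.2 hk) ?_
    have hdet' : ((a * d - b * c : ℝ) : ℂ) ≠ 0 := Complex.ofReal_ne_zero.2 hdet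
    have hk' : (k : ℂ) ≠ 0 := Complex.ofReal_ne_zero.2 hk.ne'
    rw [Complex.ofReal_inv, Complex.ofReal_inv, inv_smul_smul₀ hdet', inv_smul_smul₀ hk',
      Complex.ofReal_zero, zero_smul, sub_zero]
    exact kypProperty_halfLineForm

theorem kypProperty_of_mul_lt_sq {α β γ : ℝ} (h : α * γ < β ^ 2) :
    KYPProperty p n realLineForm !![(α : ℂ), β; β, γ] := by
  obtain ⟨s, hs, hsq⟩ : ∃ s : ℝ, 0 < s ∧ s ^ 2 = β ^ 2 - α * γ :=
    ⟨√(β ^ 2 - α * γ), Real.sqrt_pos.2 (sub_pos.2 h), Real.sq_sqrt (sub_pos.2 h).le⟩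
  -- The vectors `(a, c)` and `(b, d)` represent the two zeros of the form, `s` being the root of
  -- its discriminant; the sign of `β` decides which representatives cannot vanish.
  rcases le_or_gt β 0 with hβ | hβ
  · have hpos : 0 < s - β := by linarith
    have hdet : (s - β) * (s - β) - γ * α = 2 * s * (s - β) := by linear_combination -hsq
    refine kypProperty_of_isotropic (a := s - β) (b := γ) (c := α) (d := s - β)
      (k := 2 * s ^ 2 * (s - β)) (hdet.trans_ne (mul_pos (by positivity) hpos).ne')
      (mul_pos (by positivity) hpos) ?_ ?_ ?_
    · linear_combination α * hsq
    · linear_combination γ * hsq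
    · linear_combination (2 * s - β) * hsq
  · have hpos : 0 < s + β := by linarith
    have hdet : γ * -α - (s + β) * -(s + β) = 2 * s * (s + β) := by linear_combination -hsq
    refine kypProperty_of_isotropic (a := γ) (b := s + β) (c := -(s + β)) (d := -α)
      (k := 2 * s ^ 2 * (s + β)) (hdet.trans_ne (mul_pos (by positivity) hpos).ne')
      (mul_pos (by positivity) hpos) ?_ ?_ ?_
    · linear_combination γ * hsq
    · linear_combination α * hsq
    · linear_combination (2 * s + β) * hsq

theorem kypProperty_of_sq_le_mul {α β γ : ℝ} (hα : α ≤ 0) (hγ : γ ≤ 0) (h : β ^ 2 ≤ α * γ) :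
    KYPProperty p n realLineForm !![(α : ℂ), β; β, γ] := by
  refine kypProperty_realLineForm fun t => ?_
  have hform : (quadForm !![(α : ℂ), β; β, γ] t 1).re = α * t ^ 2 + 2 * β * t + γ := by
    have hentries : quadForm !![(α : ℂ), β; β, γ] t 1
        = ((t * (α * t + β * 1) + 1 * (β * t + γ * 1) : ℝ) : ℂ) := by
      simp [quadForm_eq]
    rw [hentries, Complex.ofReal_re]
    ring
  rw [hform]
  rcases hα.lt_or_eq with hα | rfl
  · refine nonpos_of_mul_nonneg_right (a := α) ?_ hα
    linear_combination sq_nonneg (α * t + β) + h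
  · have hβ : β = 0 := by simpa using h
    simpa [hβ] using hγ

theorem kypProperty_of_entries_nonpos {α β γ : ℝ} (hα : α ≤ 0) (hγ : γ ≤ 0) :
    KYPProperty p n realLineForm !![(α : ℂ), β; β, γ] :=
  (le_or_gt (β ^ 2) (α * γ)).elim (kypProperty_of_sq_le_mul hα hγ) kypProperty_of_mul_lt_sq

theorem kypProperty_of_curveNontrivial (hΦ : Φ.IsHermitian) (hΨ : Ψ.IsHermitian)
    (hdet : Φ.det ≠ 0) (hcurve : CurveNontrivial Φ Ψ) : KYPProperty p n Φ Ψ := by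
  obtain ⟨S, hS, hSΦ, α, β, γ, κ, hα, hγ, hSΨ⟩ := exists_normalForm hΦ hΨ hdet hcurve
  refine .of_congr hS (.of_linearCombination κ one_ne_zero one_pos ?_)
  rw [hSΦ, Complex.ofReal_one, one_smul, one_smul, hSΨ]
  exact kypProperty_of_entries_nonpos hα hγ

theorem exists_eq_smul_of_sub_mulVec_eq_zero {K p : Type*} [Field K] {F G : Matrix p n K}
    {a : n → K} {c : K × K} (hc : c ≠ 0) (ha : (c.1 • G - c.2 • F) *ᵥ a = 0) :
    ∃ y, F *ᵥ a = c.1 • y ∧ G *ᵥ a = c.2 • y := by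
  rw [sub_mulVec, smul_mulVec, smul_mulVec, sub_eq_zero] at ha
  rcases eq_or_ne c.1 0 with h₁ | h₁
  · have h₂ : c.2 ≠ 0 := fun h₂ => hc (Prod.ext h₁ h₂)
    rw [h₁, zero_smul, eq_comm, smul_eq_zero_iff_right h₂] at ha
    exact ⟨c.2⁻¹ • G *ᵥ a, by rw [ha, h₁, zero_smul], (smul_inv_smul₀ h₂ _).symm⟩
  · exact ⟨c.1⁻¹ • F *ᵥ a, (smul_inv_smul₀ h₁ _).symm, by
      rw [smul_comm, ← ha, inv_smul_smul₀ h₁]⟩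

theorem HasMultipliers.re_nonneg (hΨ : Ψ.IsHermitian) (h : HasMultipliers Φ Ψ F G M) {a : n → ℂ}
    (ha : a ∈ dict Φ Ψ F G) : 0 ≤ (star a ⬝ᵥ M *ᵥ a).re := by
  obtain ⟨P, Q, -, hQ, hPQ⟩ := h
  obtain ⟨c, ⟨hc, hΦc, hΨc⟩, hca⟩ := ha
  obtain ⟨y, hF, hG⟩ := exists_eq_smul_of_sub_mulVec_eq_zero hc hca
  have hPQa := (posSemidef_iff_re_nonneg.1 hPQ).2 a
  have hQy := mul_nonpos_of_nonpos_of_nonneg hΨc ((posSemidef_iff_re_nonneg.1 hQ).2 y)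
  rw [add_mulVec, add_mulVec, dotProduct_add, dotProduct_add,
    star_dotProduct_pencilForm_mulVec Φ P hF hG, star_dotProduct_pencilForm_mulVec Ψ Q hF hG, hΦc,
    zero_mul, add_zero, ← quadForm_ofReal_re hΨ, Complex.add_re, Complex.re_ofReal_mul] at hPQa
  linarith

theorem hasMultipliers_iff (hΦ : Φ.IsHermitian) (hΨ : Ψ.IsHermitian) (hdet : Φ.det ≠ 0)
    (hcurve : CurveNontrivial Φ Ψ) (hFG : FullRowRank F G) (hM : M.IsHermitian) :
    HasMultipliers Φ Ψ F G M ↔ ∀ a ∈ dict Φ Ψ F G, 0 ≤ (star a ⬝ᵥ M *ᵥ a).re :=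
  ⟨fun h _ => h.re_nonneg hΨ, kypProperty_of_curveNontrivial hΦ hΨ hdet hcurve F G hFG M hM⟩

end KYP

section Norm

variable {ι : Type*} [Fintype ι]

theorem euclNorm_nonneg (x : ι → ℂ) : 0 ≤ euclNorm x := norm_nonneg _

theorem euclNorm_smul (c : ℂ) (x : ι → ℂ) : euclNorm (c • x) = ‖c‖ * euclNorm x := by
  rw [euclNorm, WithLp.toLp_smul, norm_smul, euclNorm]

theorem re_star_dotProduct_le (x y : ι → ℂ) : (star x ⬝ᵥ y).re ≤ euclNorm x * euclNorm y := by
  have h := re_inner_le_norm (𝕜 := ℂ) (WithLp.toLp 2 x : EuclideanSpace ℂ ι) (WithLp.toLp 2 y)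
  rwa [EuclideanSpace.inner_eq_star_dotProduct, dotProduct_comm] at h

theorem star_dotProduct_self_eq (x : ι → ℂ) : star x ⬝ᵥ x = ((euclNorm x ^ 2 : ℝ) : ℂ) := by
  have h := inner_self_eq_norm_sq_to_K (𝕜 := ℂ) (WithLp.toLp 2 x : EuclideanSpace ℂ ι)
  rw [EuclideanSpace.inner_eq_star_dotProduct, dotProduct_comm] at h
  rw [euclNorm, Complex.ofReal_pow]
  exact h

theorem star_dotProduct_conjTranspose_mul_self_mulVec {m : Type*} [Fintype m] (E : Matrix m ι ℂ)
    (x : ι → ℂ) : star x ⬝ᵥ (Eᴴ * E) *ᵥ x = ((euclNorm (E *ᵥ x) ^ 2 : ℝ) : ℂ) := by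
  rw [← mulVec_mulVec, dotProduct_mulVec, ← star_mulVec, star_dotProduct_self_eq]

theorem euclNorm_sumElim_sq {κ : Type*} [Fintype κ] (x : ι → ℂ) (y : κ → ℂ) :
    euclNorm (Sum.elim x y) ^ 2 = euclNorm x ^ 2 + euclNorm y ^ 2 := by
  have h := star_dotProduct_self_eq (Sum.elim x y)
  rw [Function.star_sumElim, sumElim_dotProduct_sumElim, star_dotProduct_self_eq,
    star_dotProduct_self_eq] at h
  exact_mod_cast h.symm

theorem specNorm_le_one_iff {l m : Type*} [Fintype l] [Fintype m] [DecidableEq m]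
    (M : Matrix l m ℂ) : specNorm M ≤ 1 ↔ ∀ u, euclNorm (M *ᵥ u) ≤ euclNorm u := by
  classical
  rw [specNorm, Matrix.l2_opNorm_def, ContinuousLinearMap.opNorm_le_iff zero_le_one]
  simp only [one_mul]
  exact ⟨fun h u => h (WithLp.toLp 2 u), fun h u => h u.ofLp⟩

end Norm

section Gauge

variable {p n m : Type*} [Fintype n] [Fintype m] {Φ Ψ : Matrix (Fin 2) (Fin 2) ℂ}
  {F G : Matrix p n ℂ} {E : Matrix m n ℂ}

theorem zero_mem_dict (hcurve : CurveNontrivial Φ Ψ) : 0 ∈ dict Φ Ψ F G := by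
  obtain ⟨c, hc, -⟩ := hcurve
  exact ⟨c, hc, mulVec_zero _⟩

theorem symmGauge_vecMulVec_le {a : n → ℂ} (ha : a ∈ dict Φ Ψ F G) :
    symmGauge Φ Ψ F G E (vecMulVec a (star a)) ≤ ((euclNorm (E *ᵥ a) ^ 2 : ℝ) : EReal) := by
  refine (iInf₂_le 1 fun _ => a).trans ((iInf_le _ ⟨fun _ => ha, ?_⟩).trans ?_)
  · rw [Fin.sum_univ_one]
  · rw [Fin.sum_univ_one]

theorem re_trace_mul_le_symmGauge {M : Matrix n n ℂ}
    (hM : ∀ a ∈ dict Φ Ψ F G, (star a ⬝ᵥ M *ᵥ a).re ≤ euclNorm (E *ᵥ a) ^ 2)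
    (X : Matrix n n ℂ) : (((M * X).trace.re : ℝ) : EReal) ≤ symmGauge Φ Ψ F G E X := by
  refine le_iInf₂ fun r a => le_iInf fun ⟨ha, hX⟩ => EReal.coe_le_coe_iff.2 ?_
  rw [hX, Matrix.mul_sum, trace_sum, Complex.re_sum]
  refine Finset.sum_le_sum fun k _ => ?_
  rw [trace_mul_vecMulVec]
  exact hM _ (ha k)

end Gauge

section BlockBounds

variable {n₁ n₂ m₁ m₂ : Type*} [Fintype n₁] [Fintype n₂] [Fintype m₁] [Fintype m₂]

/-- Condition 3 of the theorem, for an arbitrary set `𝒜` of pairs `(v, w)`. -/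
def SumBound (𝒜 : Set (n₁ ⊕ n₂ → ℂ)) (E₁ : Matrix m₁ n₁ ℂ) (E₂ : Matrix m₂ n₂ ℂ)
    (Z : Matrix n₁ n₂ ℂ) : Prop :=
  ∀ (v : n₁ → ℂ) (w : n₂ → ℂ), Sum.elim v w ∈ 𝒜 →
    (star v ⬝ᵥ (Z *ᵥ w)).re ≤ (euclNorm (E₁ *ᵥ v) ^ 2 + euclNorm (E₂ *ᵥ w) ^ 2) / 2

/-- Condition 4 of the theorem, for an arbitrary set `𝒜` of pairs `(v, w)`. -/
def ProdBound (𝒜 : Set (n₁ ⊕ n₂ → ℂ)) (E₁ : Matrix m₁ n₁ ℂ) (E₂ : Matrix m₂ n₂ ℂ)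
    (Z : Matrix n₁ n₂ ℂ) : Prop :=
  ∀ (v : n₁ → ℂ) (w : n₂ → ℂ), Sum.elim v w ∈ 𝒜 →
    (star v ⬝ᵥ (Z *ᵥ w)).re ≤ euclNorm (E₁ *ᵥ v) * euclNorm (E₂ *ᵥ w)

variable {𝒜 : Set (n₁ ⊕ n₂ → ℂ)} {E₁ : Matrix m₁ n₁ ℂ} {E₂ : Matrix m₂ n₂ ℂ}
  {Z : Matrix n₁ n₂ ℂ}

theorem le_mul_of_forall_mul_le_sq_add_sq_div_two {x a b : ℝ} (ha : 0 ≤ a) (hb : 0 ≤ b)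
    (h : ∀ t : ℝ, t * x ≤ (a ^ 2 + (t * b) ^ 2) / 2) : x ≤ a * b := by
  have hdiscrim : discrim (b ^ 2) (-(2 * x)) (a ^ 2) ≤ 0 :=
    discrim_le_zero fun t => by linarith [h t]
  rw [discrim] at hdiscrim
  exact (le_abs_self x).trans (abs_le_of_sq_le_sq (by linarith) (mul_nonneg ha hb))

theorem sumBound_iff_prodBound
    (h𝒜 : ∀ (v : n₁ → ℂ) (w : n₂ → ℂ), Sum.elim v w ∈ 𝒜 → ∀ t : ℂ, Sum.elim v (t • w) ∈ 𝒜) :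
    SumBound 𝒜 E₁ E₂ Z ↔ ProdBound 𝒜 E₁ E₂ Z := by
  refine ⟨fun h v w hvw => ?_, fun h v w hvw => ?_⟩
  · refine le_mul_of_forall_mul_le_sq_add_sq_div_two (euclNorm_nonneg _) (euclNorm_nonneg _)
      fun t => ?_
    have ht := h v ((t : ℂ) • w) (h𝒜 v w hvw t)
    rwa [mulVec_smul, mulVec_smul, dotProduct_smul, smul_eq_mul, Complex.re_ofReal_mul,
      euclNorm_smul, Complex.norm_real, mul_pow, Real.norm_eq_abs, sq_abs, ← mul_pow] at ht
  · linarith [h v w hvw, two_mul_le_add_sq (euclNorm (E₁ *ᵥ v)) (euclNorm (E₂ *ᵥ w))]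

theorem diagBlocks_mulVec {p₁ p₂ : Type*} (M₁ : Matrix p₁ n₁ ℂ) (M₂ : Matrix p₂ n₂ ℂ)
    (v : n₁ → ℂ) (w : n₂ → ℂ) :
    diagBlocks M₁ M₂ *ᵥ Sum.elim v w = Sum.elim (M₁ *ᵥ v) (M₂ *ᵥ w) := by
  simp only [diagBlocks, fromBlocks_mulVec, Sum.elim_comp_inl, Sum.elim_comp_inr, zero_mulVec,
    add_zero, zero_add]

theorem re_star_dotProduct_fromBlocks_mulVec (Z : Matrix n₁ n₂ ℂ) (v : n₁ → ℂ) (w : n₂ → ℂ) :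
    (star (Sum.elim v w) ⬝ᵥ fromBlocks 0 Z Zᴴ 0 *ᵥ Sum.elim v w).re
      = 2 * (star v ⬝ᵥ (Z *ᵥ w)).re := by
  have hZ : star w ⬝ᵥ (Zᴴ *ᵥ v) = star (star v ⬝ᵥ (Z *ᵥ w)) := by
    rw [dotProduct_mulVec, ← star_mulVec, star_dotProduct]
  rw [fromBlocks_mulVec, Function.star_sumElim, sumElim_dotProduct_sumElim]
  simp only [Sum.elim_comp_inl, Sum.elim_comp_inr, zero_mulVec, zero_add, add_zero, hZ,
    Complex.add_re, Complex.star_def, Complex.conj_re]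
  ring

theorem sumBound_iff_forall_re_le : SumBound 𝒜 E₁ E₂ Z ↔
    ∀ a ∈ 𝒜, (star a ⬝ᵥ fromBlocks 0 Z Zᴴ 0 *ᵥ a).re ≤ euclNorm (diagBlocks E₁ E₂ *ᵥ a) ^ 2 := by
  have hpair (v : n₁ → ℂ) (w : n₂ → ℂ) :
      (star v ⬝ᵥ (Z *ᵥ w)).re ≤ (euclNorm (E₁ *ᵥ v) ^ 2 + euclNorm (E₂ *ᵥ w) ^ 2) / 2 ↔
      (star (Sum.elim v w) ⬝ᵥ fromBlocks 0 Z Zᴴ 0 *ᵥ Sum.elim v w).re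
        ≤ euclNorm (diagBlocks E₁ E₂ *ᵥ Sum.elim v w) ^ 2 := by
    rw [re_star_dotProduct_fromBlocks_mulVec, diagBlocks_mulVec, euclNorm_sumElim_sq,
      le_div_iff₀' two_pos]
  refine ⟨fun h a ha => ?_, fun h v w hvw => (hpair v w).2 (h _ hvw)⟩
  rw [← Sum.elim_comp_inl_inr a] at ha ⊢
  exact (hpair _ _).1 (h _ _ ha)

end BlockBounds

section BlockPencil

variable {p₁ p₂ n₁ n₂ m₁ m₂ : Type*} {Φ Ψ : Matrix (Fin 2) (Fin 2) ℂ}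
  {F₁ G₁ : Matrix p₁ n₁ ℂ} {F₂ G₂ : Matrix p₂ n₂ ℂ}

theorem smul_diagBlocks_sub_smul (F₁ G₁ : Matrix p₁ n₁ ℂ) (F₂ G₂ : Matrix p₂ n₂ ℂ) (μ ν : ℂ) :
    μ • diagBlocks G₁ G₂ - ν • diagBlocks F₁ F₂
      = diagBlocks (μ • G₁ - ν • F₁) (μ • G₂ - ν • F₂) := by
  ext (i | i) (j | j) <;> simp [diagBlocks]

theorem diagBlocks_conjTranspose_mul_self [Fintype m₁] [Fintype m₂] (E₁ : Matrix m₁ n₁ ℂ)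
    (E₂ : Matrix m₂ n₂ ℂ) :
    diagBlocks (E₁ᴴ * E₁) (E₂ᴴ * E₂) = (diagBlocks E₁ E₂)ᴴ * diagBlocks E₁ E₂ := by
  simp only [diagBlocks, fromBlocks_conjTranspose, fromBlocks_multiply, conjTranspose_zero,
    Matrix.mul_zero, Matrix.zero_mul, add_zero, zero_add]

theorem lmiFeasible_iff_hasMultipliers [Fintype p₁] [Fintype p₂] [Fintype m₁] [Fintype m₂]
    {E₁ : Matrix m₁ n₁ ℂ} {E₂ : Matrix m₂ n₂ ℂ} {Z : Matrix n₁ n₂ ℂ} :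
    LMIFeasible Φ Ψ F₁ G₁ F₂ G₂ E₁ E₂ Z ↔
      HasMultipliers Φ Ψ (diagBlocks F₁ F₂) (diagBlocks G₁ G₂)
        (diagBlocks (E₁ᴴ * E₁) (E₂ᴴ * E₂) - fromBlocks 0 Z Zᴴ 0) := by
  simp only [LMIFeasible, HasMultipliers, pencilForm, LinearMap.coe_mk, AddHom.coe_mk,
    Matrix.mul_add, Matrix.add_mul, sub_sub_eq_add_sub, ← sub_add_eq_add_sub, ← add_assoc]

variable [Fintype n₁] [Fintype n₂]

theorem sumElim_mem_dict {v : n₁ → ℂ} {w : n₂ → ℂ} :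
    Sum.elim v w ∈ dict Φ Ψ (diagBlocks F₁ F₂) (diagBlocks G₁ G₂) ↔
      ∃ c ∈ curve Φ Ψ, (c.1 • G₁ - c.2 • F₁) *ᵥ v = 0 ∧ (c.1 • G₂ - c.2 • F₂) *ᵥ w = 0 := by
  have hzero (x : p₁ → ℂ) (y : p₂ → ℂ) : Sum.elim x y = 0 ↔ x = 0 ∧ y = 0 := by
    rw [← Sum.elim_zero_zero, Sum.elim_eq_iff]
  simp only [dict, Set.mem_ofPred_eq, smul_diagBlocks_sub_smul, diagBlocks_mulVec, hzero]

theorem sumElim_smul_mem_dict {v : n₁ → ℂ} {w : n₂ → ℂ}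
    (h : Sum.elim v w ∈ dict Φ Ψ (diagBlocks F₁ F₂) (diagBlocks G₁ G₂)) (s t : ℂ) :
    Sum.elim (s • v) (t • w) ∈ dict Φ Ψ (diagBlocks F₁ F₂) (diagBlocks G₁ G₂) := by
  obtain ⟨c, hc, hv, hw⟩ := sumElim_mem_dict.1 h
  exact sumElim_mem_dict.2
    ⟨c, hc, by rw [mulVec_smul, hv, smul_zero], by rw [mulVec_smul, hw, smul_zero]⟩

variable [Fintype m₁] [Fintype m₂] {E₁ : Matrix m₁ n₁ ℂ} {E₂ : Matrix m₂ n₂ ℂ}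
  {Z : Matrix n₁ n₂ ℂ}

theorem sumBound_dict_iff_prodBound :
    SumBound (dict Φ Ψ (diagBlocks F₁ F₂) (diagBlocks G₁ G₂)) E₁ E₂ Z ↔
      ProdBound (dict Φ Ψ (diagBlocks F₁ F₂) (diagBlocks G₁ G₂)) E₁ E₂ Z :=
  sumBound_iff_prodBound fun v w h t => by
    simpa only [one_smul] using sumElim_smul_mem_dict h 1 t

theorem lmiFeasible_iff_sumBound [Fintype p₁] [Fintype p₂] (hΦ : Φ.IsHermitian)
    (hΨ : Ψ.IsHermitian) (hdet : Φ.det ≠ 0) (hcurve : CurveNontrivial Φ Ψ)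
    (hrank : FullRowRank (diagBlocks F₁ F₂) (diagBlocks G₁ G₂)) :
    LMIFeasible Φ Ψ F₁ G₁ F₂ G₂ E₁ E₂ Z ↔
      SumBound (dict Φ Ψ (diagBlocks F₁ F₂) (diagBlocks G₁ G₂)) E₁ E₂ Z := by
  have hgap : (diagBlocks (E₁ᴴ * E₁) (E₂ᴴ * E₂) - fromBlocks 0 Z Zᴴ 0).IsHermitian := by
    rw [diagBlocks_conjTranspose_mul_self]
    exact (isHermitian_conjTranspose_mul_self _).sub
      (isHermitian_zero.fromBlocks rfl isHermitian_zero)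
  rw [lmiFeasible_iff_hasMultipliers, hasMultipliers_iff hΦ hΨ hdet hcurve hrank hgap,
    sumBound_iff_forall_re_le]
  simp only [diagBlocks_conjTranspose_mul_self, sub_mulVec, dotProduct_sub,
    star_dotProduct_conjTranspose_mul_self_mulVec, Complex.sub_re, Complex.ofReal_re, sub_nonneg]

end BlockPencil

section Conjugate

variable {p₁ p₂ n₁ n₂ m₁ m₂ : Type*} [Fintype n₁] [Fintype n₂] [Fintype m₁] [Fintype m₂]
  {Φ Ψ : Matrix (Fin 2) (Fin 2) ℂ} {F₁ G₁ : Matrix p₁ n₁ ℂ} {F₂ G₂ : Matrix p₂ n₂ ℂ}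
  {E₁ : Matrix m₁ n₁ ℂ} {E₂ : Matrix m₂ n₂ ℂ} {Z : Matrix n₁ n₂ ℂ}

theorem nonsymmGauge_vecMulVec_le {v : n₁ → ℂ} {w : n₂ → ℂ}
    (h : Sum.elim v w ∈ dict Φ Ψ (diagBlocks F₁ F₂) (diagBlocks G₁ G₂)) :
    nonsymmGauge Φ Ψ F₁ G₁ F₂ G₂ E₁ E₂ (vecMulVec v (star w))
      ≤ (((euclNorm (E₁ *ᵥ v) ^ 2 + euclNorm (E₂ *ᵥ w) ^ 2) / 2 : ℝ) : EReal) := by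
  have hblocks : fromBlocks (vecMulVec v (star v)) (vecMulVec v (star w))
      (vecMulVec v (star w))ᴴ (vecMulVec w (star w))
        = vecMulVec (Sum.elim v w) (star (Sum.elim v w)) := by
    ext (i | i) (j | j) <;> simp [vecMulVec_apply]
  have hgauge := symmGauge_vecMulVec_le (E := diagBlocks E₁ E₂) h
  rw [← hblocks, diagBlocks_mulVec, euclNorm_sumElim_sq] at hgauge
  have hhalf : (0 : EReal) ≤ ((1 / 2 : ℝ) : EReal) := EReal.coe_nonneg.2 (by norm_num)
  refine (mul_le_mul_of_nonneg_left ((iInf₂_le _ _).trans hgauge) hhalf).trans_eq ?_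
  rw [← EReal.coe_mul, one_div_mul_eq_div]

theorem re_trace_fromBlocks_mul_fromBlocks (Z Y : Matrix n₁ n₂ ℂ) (V : Matrix n₁ n₁ ℂ)
    (W : Matrix n₂ n₂ ℂ) :
    (fromBlocks 0 Z Zᴴ 0 * fromBlocks V Y Yᴴ W).trace.re = 2 * (Zᴴ * Y).trace.re := by
  have hstar : (Z * Yᴴ).trace = star (Zᴴ * Y).trace := by
    rw [← trace_conjTranspose, conjTranspose_mul, conjTranspose_conjTranspose, trace_mul_comm]
  have hsum : (fromBlocks 0 Z Zᴴ 0 * fromBlocks V Y Yᴴ W).trace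
      = (Z * Yᴴ).trace + (Zᴴ * Y).trace := by
    simp only [fromBlocks_multiply, Matrix.zero_mul, zero_add, add_zero, Matrix.trace, diag_apply,
      Fintype.sum_sum_type, fromBlocks_apply₁₁, fromBlocks_apply₂₂]
  rw [hsum, hstar, Complex.add_re, Complex.star_def, Complex.conj_re, two_mul]

theorem SumBound.re_trace_le_nonsymmGauge
    (h : SumBound (dict Φ Ψ (diagBlocks F₁ F₂) (diagBlocks G₁ G₂)) E₁ E₂ Z)
    (Y : Matrix n₁ n₂ ℂ) :
    (((Zᴴ * Y).trace.re : ℝ) : EReal) ≤ nonsymmGauge Φ Ψ F₁ G₁ F₂ G₂ E₁ E₂ Y := by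
  have hhalf : (0 : EReal) ≤ ((1 / 2 : ℝ) : EReal) := EReal.coe_nonneg.2 (by norm_num)
  refine Eq.trans_le ?_ (mul_le_mul_of_nonneg_left (le_iInf₂ fun V W =>
    (re_trace_fromBlocks_mul_fromBlocks Z Y V W).symm ▸
      re_trace_mul_le_symmGauge (sumBound_iff_forall_re_le.1 h) _) hhalf)
  rw [← EReal.coe_mul, one_div, inv_mul_cancel_left₀ two_ne_zero]

theorem le_conjugate_nonsymmGauge {v : n₁ → ℂ} {w : n₂ → ℂ}
    (h : Sum.elim v w ∈ dict Φ Ψ (diagBlocks F₁ F₂) (diagBlocks G₁ G₂)) :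
    (((star v ⬝ᵥ (Z *ᵥ w)).re
        - (euclNorm (E₁ *ᵥ v) ^ 2 + euclNorm (E₂ *ᵥ w) ^ 2) / 2 : ℝ) : EReal)
      ≤ conjugate (nonsymmGauge Φ Ψ F₁ G₁ F₂ G₂ E₁ E₂) Z := by
  have htrace : (Zᴴ * vecMulVec v (star w)).trace = star (star v ⬝ᵥ (Z *ᵥ w)) := by
    rw [trace_mul_vecMulVec, dotProduct_mulVec, ← star_mulVec, star_dotProduct]
  refine le_trans ?_ (le_iSup _ (vecMulVec v (star w)))
  rw [htrace, Complex.star_def, Complex.conj_re, EReal.coe_sub]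
  exact EReal.sub_le_sub le_rfl (nonsymmGauge_vecMulVec_le h)

theorem SumBound.conjugate_eq_zero (hcurve : CurveNontrivial Φ Ψ)
    (h : SumBound (dict Φ Ψ (diagBlocks F₁ F₂) (diagBlocks G₁ G₂)) E₁ E₂ Z) :
    conjugate (nonsymmGauge Φ Ψ F₁ G₁ F₂ G₂ E₁ E₂) Z = 0 := by
  refine le_antisymm (iSup_le fun Y => EReal.sub_nonpos.2 (h.re_trace_le_nonsymmGauge Y)) ?_
  have hzero : (Sum.elim 0 0 : n₁ ⊕ n₂ → ℂ) ∈ dict Φ Ψ (diagBlocks F₁ F₂) (diagBlocks G₁ G₂) := by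
    rw [Sum.elim_zero_zero]
    exact zero_mem_dict hcurve
  simpa [euclNorm] using le_conjugate_nonsymmGauge (E₁ := E₁) (E₂ := E₂) (Z := Z) hzero

theorem conjugate_eq_top_of_not_sumBound
    (h : ¬ SumBound (dict Φ Ψ (diagBlocks F₁ F₂) (diagBlocks G₁ G₂)) E₁ E₂ Z) :
    conjugate (nonsymmGauge Φ Ψ F₁ G₁ F₂ G₂ E₁ E₂) Z = ⊤ := by
  simp only [SumBound, not_forall, not_le] at h
  obtain ⟨v, w, hvw, hlt⟩ := h
  set δ := (star v ⬝ᵥ (Z *ᵥ w)).re - (euclNorm (E₁ *ᵥ v) ^ 2 + euclNorm (E₂ *ᵥ w) ^ 2) / 2 with hδ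
  have hδpos : 0 < δ := sub_pos.2 hlt
  have hscale (t : ℝ) : ((t ^ 2 * δ : ℝ) : EReal)
      ≤ conjugate (nonsymmGauge Φ Ψ F₁ G₁ F₂ G₂ E₁ E₂) Z := by
    convert le_conjugate_nonsymmGauge (E₁ := E₁) (E₂ := E₂) (Z := Z)
      (sumElim_smul_mem_dict hvw t t) using 2
    simp only [mulVec_smul, euclNorm_smul, star_smul, smul_dotProduct, dotProduct_smul, mul_pow,
      Complex.star_def, Complex.conj_ofReal, smul_eq_mul, Complex.re_ofReal_mul,
      Complex.norm_real, Real.norm_eq_abs, sq_abs, hδ]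
    ring
  refine (EReal.eq_top_iff_forall_lt _).2 fun y => lt_of_lt_of_le ?_ (hscale √((|y| + 1) / δ))
  rw [Real.sq_sqrt (by positivity), div_mul_cancel₀ _ hδpos.ne']
  exact EReal.coe_lt_coe_iff.2 (by linarith [le_abs_self y])

theorem conjugate_eq_zero_iff (hcurve : CurveNontrivial Φ Ψ) :
    conjugate (nonsymmGauge Φ Ψ F₁ G₁ F₂ G₂ E₁ E₂) Z = 0 ↔
      SumBound (dict Φ Ψ (diagBlocks F₁ F₂) (diagBlocks G₁ G₂)) E₁ E₂ Z := by
  refine ⟨fun h => ?_, SumBound.conjugate_eq_zero hcurve⟩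
  contrapose! h
  rw [conjugate_eq_top_of_not_sumBound h]
  exact EReal.top_ne_zero

end Conjugate

section EmptyRows

variable {p₁ p₂ n₁ n₂ m₂ : Type*} [IsEmpty p₁] [Fintype n₁] [Fintype n₂]
  {Φ Ψ : Matrix (Fin 2) (Fin 2) ℂ} {F₁ G₁ : Matrix p₁ n₁ ℂ} {F₂ G₂ : Matrix p₂ n₂ ℂ}

theorem fullRowRank_diagBlocks_of_isEmpty [Fintype p₁] [Fintype p₂] (h : FullRowRank F₂ G₂) :
    FullRowRank (diagBlocks F₁ F₂) (diagBlocks G₁ G₂) := by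
  refine fullRowRank_iff_surjective_mulVec.2 fun μ ν hμν y => ?_
  obtain ⟨w, hw⟩ := fullRowRank_iff_surjective_mulVec.1 h μ ν hμν (y ∘ Sum.inr)
  refine ⟨Sum.elim 0 w, ?_⟩
  rw [smul_diagBlocks_sub_smul, diagBlocks_mulVec, hw, ← Sum.elim_comp_inl_inr y,
    Subsingleton.elim ((μ • G₁ - ν • F₁) *ᵥ 0) (y ∘ Sum.inl), Sum.elim_comp_inr]

theorem sumElim_mem_dict_of_isEmpty {v : n₁ → ℂ} {w : n₂ → ℂ} :
    Sum.elim v w ∈ dict Φ Ψ (diagBlocks F₁ F₂) (diagBlocks G₁ G₂) ↔ w ∈ dict Φ Ψ F₂ G₂ := by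
  simp only [sumElim_mem_dict, Subsingleton.elim _ (0 : p₁ → ℂ), true_and]
  rfl

theorem prodBound_one_iff_of_isEmpty [Fintype m₂] [DecidableEq n₁] {E₂ : Matrix m₂ n₂ ℂ}
    {Z : Matrix n₁ n₂ ℂ} :
    ProdBound (dict Φ Ψ (diagBlocks F₁ F₂) (diagBlocks G₁ G₂)) (1 : Matrix n₁ n₁ ℂ) E₂ Z ↔
      ∀ w ∈ dict Φ Ψ F₂ G₂, euclNorm (Z *ᵥ w) ≤ euclNorm (E₂ *ᵥ w) := by
  simp only [ProdBound, sumElim_mem_dict_of_isEmpty, one_mulVec]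
  refine ⟨fun h w hw => ?_, fun h v w hw => ?_⟩
  · have hZw := h (Z *ᵥ w) w hw
    rw [star_dotProduct_self_eq, Complex.ofReal_re, sq] at hZw
    rcases (euclNorm_nonneg (Z *ᵥ w)).eq_or_lt with hzero | hpos
    · exact hzero ▸ euclNorm_nonneg _
    · exact le_of_mul_le_mul_left hZw hpos
  · exact (re_star_dotProduct_le _ _).trans
      (mul_le_mul_of_nonneg_left (h w hw) (euclNorm_nonneg v))

end EmptyRows

section StateSpace

variable {Φ Ψ : Matrix (Fin 2) (Fin 2) ℂ} {s m l : Type*} [Fintype s] [Fintype m]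

theorem mem_dict_iff {p n : Type*} [Fintype n] {F G : Matrix p n ℂ} {a : n → ℂ} :
    a ∈ dict Φ Ψ F G ↔ (∃ z, (z, 1) ∈ curve Φ Ψ ∧ F *ᵥ a = z • G *ᵥ a) ∨
      ((1, 0) ∈ curve Φ Ψ ∧ G *ᵥ a = 0) := by
  have hmem : a ∈ dict Φ Ψ F G ↔ ∃ c ∈ curve Φ Ψ, c.2 • F *ᵥ a = c.1 • G *ᵥ a := by
    simp only [dict, Set.mem_ofPred_eq, sub_mulVec, smul_mulVec, sub_eq_zero, eq_comm]
  rw [hmem]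
  constructor
  · rintro ⟨⟨μ, ν⟩, hc, hFG⟩
    rcases eq_or_ne ν 0 with rfl | hν
    · have hμ : μ ≠ 0 := fun hμ => hc.1 (Prod.ext hμ rfl)
      have hinf := smul_mem_curve (inv_ne_zero hμ) hc
      rw [Prod.smul_mk, smul_eq_mul, inv_mul_cancel₀ hμ, smul_zero] at hinf
      exact .inr ⟨hinf, (smul_eq_zero_iff_right hμ).1 (hFG.symm.trans (zero_smul ℂ _))⟩
    · have hfin := smul_mem_curve (inv_ne_zero hν) hc
      rw [Prod.smul_mk, smul_eq_mul, smul_eq_mul, inv_mul_cancel₀ hν] at hfin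
      exact .inl ⟨_, hfin, by rw [mul_smul, ← hFG, inv_smul_smul₀ hν]⟩
  · rintro (⟨z, hz, hFG⟩ | ⟨hinf, hG⟩)
    · exact ⟨_, hz, by rw [one_smul, hFG]⟩
    · exact ⟨_, hinf, by rw [hG, zero_smul, smul_zero]⟩

theorem isUnit_det_of_not_hasEigenvalue {K : Type*} [Field K] [DecidableEq s] {A : Matrix s s K}
    {z : K} (h : ¬ Module.End.HasEigenvalue (Matrix.toLin' A) z) :
    IsUnit (z • (1 : Matrix s s K) - A).det := by
  rw [isUnit_iff_ne_zero]
  contrapose! h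
  obtain ⟨x, hx, hxA⟩ := exists_mulVec_eq_zero_iff.2 h
  rw [sub_mulVec, smul_mulVec, one_mulVec, sub_eq_zero] at hxA
  exact Module.End.hasEigenvalue_of_hasEigenvector
    ⟨Module.End.mem_eigenspace_iff.2 ((toLin'_apply A x).trans hxA.symm), hx⟩

theorem mulVec_add_eq_smul_iff {R : Type*} [CommRing R] [DecidableEq s] {A : Matrix s s R} {z : R}
    (hz : IsUnit (z • (1 : Matrix s s R) - A).det) {x y : s → R} :
    A *ᵥ x + y = z • x ↔ x = (z • (1 : Matrix s s R) - A)⁻¹ *ᵥ y := by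
  have hsub : A *ᵥ x + y = z • x ↔ (z • (1 : Matrix s s R) - A) *ᵥ x = y := by
    rw [sub_mulVec, smul_mulVec, one_mulVec, sub_eq_iff_eq_add', eq_comm]
  refine hsub.trans ⟨?_, ?_⟩
  · rintro rfl
    rw [mulVec_mulVec, nonsing_inv_mul _ hz, one_mulVec]
  · rintro rfl
    rw [mulVec_mulVec, mul_nonsing_inv _ hz, one_mulVec]

theorem fromCols_mulVec_sumElim_mulVec {R k : Type*} [Semiring R] [Fintype k] (C : Matrix l s R)
    (D : Matrix l m R) (M : Matrix s k R) (B : Matrix k m R) (u : m → R) :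
    fromCols C D *ᵥ Sum.elim (M *ᵥ B *ᵥ u) u = (D + C * M * B) *ᵥ u := by
  rw [fromCols_mulVec_sumElim, add_mulVec, ← mulVec_mulVec, ← mulVec_mulVec, add_comm]

variable [DecidableEq s] {A : Matrix s s ℂ} {B : Matrix s m ℂ} {C : Matrix l s ℂ}
  {D : Matrix l m ℂ}

theorem sumElim_mem_dict_state_iff
    (hA : ∀ z : ℂ, Module.End.HasEigenvalue (Matrix.toLin' A) z → (z, (1 : ℂ)) ∉ curve Φ Ψ)
    {x : s → ℂ} {u : m → ℂ} :
    Sum.elim x u ∈ dict Φ Ψ (fromCols A B) (fromCols 1 0) ↔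
      (∃ z, (z, 1) ∈ curve Φ Ψ ∧ x = (z • (1 : Matrix s s ℂ) - A)⁻¹ *ᵥ B *ᵥ u) ∨
      ((1, 0) ∈ curve Φ Ψ ∧ x = 0) := by
  have hresolvent (z : ℂ) (hz : (z, 1) ∈ curve Φ Ψ) := mulVec_add_eq_smul_iff (x := x)
    (y := B *ᵥ u) (isUnit_det_of_not_hasEigenvalue fun h => hA z h hz)
  simp only [mem_dict_iff, fromCols_mulVec_sumElim, one_mulVec, zero_mulVec, add_zero]
  exact or_congr_left (exists_congr fun z => and_congr_right fun hz => hresolvent z hz)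

theorem forall_euclNorm_le_iff_transferBound [Fintype l] [DecidableEq m]
    (hA : ∀ z : ℂ, Module.End.HasEigenvalue (Matrix.toLin' A) z → (z, (1 : ℂ)) ∉ curve Φ Ψ) :
    (∀ w ∈ dict Φ Ψ (fromCols A B) (fromCols 1 0),
      euclNorm (fromCols C D *ᵥ w) ≤ euclNorm ((fromCols 0 1 : Matrix m (s ⊕ m) ℂ) *ᵥ w)) ↔
      TransferBound Φ Ψ A B C D := by
  have hinput (x : s → ℂ) (u : m → ℂ) :
      (fromCols 0 1 : Matrix m (s ⊕ m) ℂ) *ᵥ Sum.elim x u = u := by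
    rw [fromCols_mulVec_sumElim, zero_mulVec, one_mulVec, zero_add]
  have hfeedthrough (u : m → ℂ) : fromCols C D *ᵥ Sum.elim 0 u = D *ᵥ u := by
    rw [fromCols_mulVec_sumElim, mulVec_zero, zero_add]
  simp only [TransferBound, specNorm_le_one_iff]
  constructor
  · refine fun h => ⟨fun z hz u => ?_, fun hinf u => ?_⟩
    · simpa only [hinput, fromCols_mulVec_sumElim_mulVec] using
        h _ ((sumElim_mem_dict_state_iff hA (u := u)).2 (.inl ⟨z, hz, rfl⟩))
    · simpa only [hinput, hfeedthrough] using
        h _ ((sumElim_mem_dict_state_iff hA (u := u)).2 (.inr ⟨hinf, rfl⟩))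
  · rintro ⟨hfin, hinf⟩ w hw
    obtain ⟨x, u, rfl⟩ : ∃ x u, w = Sum.elim x u := ⟨_, _, (Sum.elim_comp_inl_inr w).symm⟩
    rw [hinput]
    rcases (sumElim_mem_dict_state_iff hA).1 hw with ⟨z, hz, rfl⟩ | ⟨h, rfl⟩
    · exact fromCols_mulVec_sumElim_mulVec C D _ B u ▸ hfin z hz u
    · exact hfeedthrough u ▸ hinf h u

end StateSpace

end PencilGauge

theorem mainTheorem5 (Φ Ψ : Matrix (Fin 2) (Fin 2) ℂ) (hΦ : Φ.IsHermitian) (hΨ : Ψ.IsHermitian)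
    (hdet : Φ.det.re < 0) (hcurve : PencilGauge.CurveNontrivial Φ Ψ) :
    -- the conjugate of the gauge of a block-diagonal pencil
    (∀ (p₁ p₂ n₁ n₂ m₁ m₂ : Type*) [Fintype p₁] [Fintype p₂] [Fintype n₁] [Fintype n₂]
      [Fintype m₁] [Fintype m₂]
      (F₁ G₁ : Matrix p₁ n₁ ℂ) (F₂ G₂ : Matrix p₂ n₂ ℂ)
      (E₁ : Matrix m₁ n₁ ℂ) (E₂ : Matrix m₂ n₂ ℂ),
      PencilGauge.FullRowRank (PencilGauge.diagBlocks F₁ F₂) (PencilGauge.diagBlocks G₁ G₂) →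
      ∀ Z : Matrix n₁ n₂ ℂ,
        (PencilGauge.conjugate (PencilGauge.nonsymmGauge Φ Ψ F₁ G₁ F₂ G₂ E₁ E₂) Z = 0 ↔
          PencilGauge.LMIFeasible Φ Ψ F₁ G₁ F₂ G₂ E₁ E₂ Z) ∧
        (¬ PencilGauge.LMIFeasible Φ Ψ F₁ G₁ F₂ G₂ E₁ E₂ Z →
          PencilGauge.conjugate (PencilGauge.nonsymmGauge Φ Ψ F₁ G₁ F₂ G₂ E₁ E₂) Z = ⊤) ∧
        (PencilGauge.LMIFeasible Φ Ψ F₁ G₁ F₂ G₂ E₁ E₂ Z ↔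
          ∀ (v : n₁ → ℂ) (w : n₂ → ℂ),
            Sum.elim v w ∈ PencilGauge.dict Φ Ψ
              (PencilGauge.diagBlocks F₁ F₂) (PencilGauge.diagBlocks G₁ G₂) →
            (star v ⬝ᵥ (Z *ᵥ w)).re ≤
              (PencilGauge.euclNorm (E₁ *ᵥ v) ^ 2 + PencilGauge.euclNorm (E₂ *ᵥ w) ^ 2) / 2) ∧
        (PencilGauge.LMIFeasible Φ Ψ F₁ G₁ F₂ G₂ E₁ E₂ Z ↔
          ∀ (v : n₁ → ℂ) (w : n₂ → ℂ),
            Sum.elim v w ∈ PencilGauge.dict Φ Ψ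
              (PencilGauge.diagBlocks F₁ F₂) (PencilGauge.diagBlocks G₁ G₂) →
            (star v ⬝ᵥ (Z *ᵥ w)).re ≤
              PencilGauge.euclNorm (E₁ *ᵥ v) * PencilGauge.euclNorm (E₂ *ᵥ w))) ∧
    -- the state-space pencil: `p₁ = 0`, `G₂ = [I 0]`, `F₂ = [A B]`, `E₁ = I`, `E₂ = [0 I]`,
    -- `Z = [C D]`
    (∀ (s m l : Type*) [Fintype s] [Fintype m] [Fintype l] [DecidableEq s] [DecidableEq m]
      [DecidableEq l]
      (A : Matrix s s ℂ) (B : Matrix s m ℂ) (C : Matrix l s ℂ) (D : Matrix l m ℂ),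
      (∀ z : ℂ, Module.End.HasEigenvalue (Matrix.toLin' A) z →
        (z, (1 : ℂ)) ∉ PencilGauge.curve Φ Ψ) →
      ∀ (F₁ G₁ : Matrix (Fin 0) l ℂ) (F₂ G₂ : Matrix s (s ⊕ m) ℂ)
        (E₁ : Matrix l l ℂ) (E₂ : Matrix m (s ⊕ m) ℂ) (Z : Matrix l (s ⊕ m) ℂ),
        F₂ = fromCols A B → G₂ = fromCols 1 0 → E₁ = 1 → E₂ = fromCols 0 1 →
        Z = fromCols C D →
        ((∀ (v : l → ℂ) (w : s ⊕ m → ℂ),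
            Sum.elim v w ∈ PencilGauge.dict Φ Ψ
              (PencilGauge.diagBlocks F₁ F₂) (PencilGauge.diagBlocks G₁ G₂) →
            (star v ⬝ᵥ (Z *ᵥ w)).re ≤
              PencilGauge.euclNorm (E₁ *ᵥ v) * PencilGauge.euclNorm (E₂ *ᵥ w)) ↔
          ∀ w ∈ PencilGauge.dict Φ Ψ F₂ G₂,
            PencilGauge.euclNorm (Z *ᵥ w) ≤ PencilGauge.euclNorm (E₂ *ᵥ w)) ∧
        ((∀ w ∈ PencilGauge.dict Φ Ψ F₂ G₂,
            PencilGauge.euclNorm (Z *ᵥ w) ≤ PencilGauge.euclNorm (E₂ *ᵥ w)) ↔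
          PencilGauge.TransferBound Φ Ψ A B C D) ∧
        (PencilGauge.conjugate (PencilGauge.nonsymmGauge Φ Ψ F₁ G₁ F₂ G₂ E₁ E₂) Z = 0 ↔
          PencilGauge.TransferBound Φ Ψ A B C D) ∧
        (¬ PencilGauge.TransferBound Φ Ψ A B C D →
          PencilGauge.conjugate (PencilGauge.nonsymmGauge Φ Ψ F₁ G₁ F₂ G₂ E₁ E₂) Z = ⊤) ∧
        (PencilGauge.FullRowRank F₂ G₂ →
          (PencilGauge.LMIFeasible Φ Ψ F₁ G₁ F₂ G₂ E₁ E₂ Z ↔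
            PencilGauge.TransferBound Φ Ψ A B C D))) := by
  have hdet' : Φ.det ≠ 0 := fun h => by simp [h] at hdet
  constructor
  · intro p₁ p₂ n₁ n₂ m₁ m₂ _ _ _ _ _ _ F₁ G₁ F₂ G₂ E₁ E₂ hrank Z
    have hLMI := PencilGauge.lmiFeasible_iff_sumBound (E₁ := E₁) (E₂ := E₂) (Z := Z) hΦ hΨ hdet'
      hcurve hrank
    refine ⟨?_, fun h => ?_, hLMI, hLMI.trans PencilGauge.sumBound_dict_iff_prodBound⟩
    · rw [PencilGauge.conjugate_eq_zero_iff hcurve, hLMI]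
    · exact PencilGauge.conjugate_eq_top_of_not_sumBound (mt hLMI.2 h)
  · rintro s m l _ _ _ _ _ _ A B C D hA F₁ G₁ _ _ _ _ _ rfl rfl rfl rfl rfl
    have hprod := PencilGauge.prodBound_one_iff_of_isEmpty (Φ := Φ) (Ψ := Ψ) (F₁ := F₁) (G₁ := G₁)
      (F₂ := fromCols A B) (G₂ := fromCols 1 0) (E₂ := (fromCols 0 1 : Matrix m (s ⊕ m) ℂ))
      (Z := fromCols C D)
    have htransfer := PencilGauge.forall_euclNorm_le_iff_transferBound (B := B) (C := C) (D := D) hA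
    have hsum := PencilGauge.sumBound_dict_iff_prodBound.trans (hprod.trans htransfer)
    refine ⟨hprod, htransfer, ?_, fun h => ?_, fun hrank => ?_⟩
    · rw [PencilGauge.conjugate_eq_zero_iff hcurve, hsum]
    · exact PencilGauge.conjugate_eq_top_of_not_sumBound (mt hsum.1 h)
    · rw [PencilGauge.lmiFeasible_iff_sumBound hΦ hΨ hdet' hcurve
        (PencilGauge.fullRowRank_diagBlocks_of_isEmpty hrank), hsum]
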